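/- Let $\mathcal T$ be an essentially small triangulated category in which every object is isomorphic to a finite direct sum of indecomposable (in particular non-zero) objects. Assume that $\mathcal T$ is a block, i.e. that $\mathcal T$ is not triangle equivalent to a product of two non-zero triangulated categories. A path $X\rightsquigarrow Y$ between indecomposable objects is a finite sequence $X=X_0,X_1,\dots,X_n=Y$ ($n\ge 0$) of indecomposable objects such that for each $i<n$ there is a non-zero morphism $X_i\to X_{i+1}$ or $X_{i+1}\cong X_i[1]$. For an indecomposable object $M$ let $$\mathcal T_M^{\le 0}=\mathrm{add}\{Y \text{ indecomposable} : \text{there is a path } M\rightsquigarrow Y\},\qquad \mathcal T_M^{\ge 0}=\mathrm{add}\{Z \text{ indecomposable} : \text{there is no path } M\rightsquigarrow Z[-1]\},$$ where $\mathrm{add}$ denotes the full subcategory of all objects isomorphic to finite direct sums of the given ones. The pair $(\mathcal T_M^{\le 0},\mathcal T_M^{\ge 0})$ is a (split) t-structure on $\mathcal T$, so its heart $\mathcal H=\mathcal T_M^{\le 0}\cap\mathcal T_M^{\ge 0}$ is an abelian category. Theorem. If $M$ is an indecomposable object of $\mathcal T$ such that there is no path from $M$ to $M[-1]$, then $\mathcal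 T$ is triangle equivalent to the bounded derived category $\mathcal D^b(\mathcal H)$. -/

import Mathlib

open CategoryTheory Limits Pretriangulated Triangulated

universe w w' v u

namespace PathTriang

noncomputable section

set_option linter.unusedSectionVars false

variable {C : Type u} [Category.{v} C] [Preadditive C] [HasZeroObject C] [HasShift C ℤ]
  [∀ n : ℤ, (shiftFunctor C n).Additive] [Pretriangulated C]

/-! ### Finite direct sums, paths, blocks -/

/-- `add P`: the objects isomorphic to a finite (possibly empty) direct sum of objects
satisfying `P`. -/
def additiveClosure (P : C → Prop) : ObjectProperty C := fun X =>
  ∃ (n : ℕ) (Y : Fin n → C), (∀ i, P (Y i)) ∧ Nonempty (X ≅ ⨁ Y)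

variable (C) in
/-- Every object is isomorphic to a finite direct sum of indecomposable objects. (Indecomposable
objects are non-zero by definition.) -/
def HasIndecomposableDecompositions : Prop :=
  ∀ X : C, additiveClosure (fun Y : C => Indecomposable Y) X

/-- One step of a path: `X` and `Y` are indecomposable, and there is a non-zero morphism `X ⟶ Y`
or `Y` is (isomorphic to) `X[1]`. -/
def PathStep (X Y : C) : Prop :=
  Indecomposable X ∧ Indecomposable Y ∧
    ((∃ f : X ⟶ Y, f ≠ 0) ∨ Nonempty (Y ≅ X⟦(1 : ℤ)⟧))

/-- There is a path `X = X₀, X₁, …, Xₙ = Y`, `n ≥ 0`, of indecomposable objects from `X` to `Y`. -/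
def HasPath (X Y : C) : Prop :=
  Indecomposable X ∧ Indecomposable Y ∧ Relation.ReflTransGen PathStep X Y

variable (C) in
/-- `C` is a block: it is not triangle equivalent to a product `A × B` of two non-zero
triangulated categories. Shift and distinguished triangles of `A × B` are componentwise, so a
triangle functor `C ⥤ A × B` is the same thing as a pair of triangle functors `F : C ⥤ A` and
`G : C ⥤ B`. The two factors of `C` are equivalent to full subcategories of `C`, so nothing is
lost by taking `A` and `B` in the universes of `C`. -/
def IsBlock : Prop :=
  ∀ (A B : Type u) [Category.{v} A] [Category.{v} B] [Preadditive A] [Preadditive B]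
    [HasZeroObject A] [HasZeroObject B] [HasShift A ℤ] [HasShift B ℤ]
    [∀ n : ℤ, (shiftFunctor A n).Additive] [∀ n : ℤ, (shiftFunctor B n).Additive]
    [Pretriangulated A] [Pretriangulated B] [IsTriangulated A] [IsTriangulated B]
    (F : C ⥤ A) (G : C ⥤ B) [F.CommShift ℤ] [G.CommShift ℤ],
    F.IsTriangulated → G.IsTriangulated → (F.prod' G).IsEquivalence →
      (∀ X : A, IsZero X) ∨ (∀ Y : B, IsZero Y)

/-- Two triangulated categories are triangle equivalent if there is a functor between them which
is an equivalence, commutes with the shifts and preserves distinguished triangles. -/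
def TriangleEquivalent (A : Type*) (B : Type*) [Category* A] [Category* B]
    [Preadditive A] [Preadditive B] [HasZeroObject A] [HasZeroObject B]
    [HasShift A ℤ] [HasShift B ℤ]
    [∀ n : ℤ, (shiftFunctor A n).Additive] [∀ n : ℤ, (shiftFunctor B n).Additive]
    [Pretriangulated A] [Pretriangulated B] : Prop :=
  ∃ (F : A ⥤ B) (_ : F.CommShift ℤ), F.IsTriangulated ∧ F.IsEquivalence

/-! ### The t-structure determined by an object -/

/-- `add {Y indecomposable | there is a path M ⇝ Y}`. -/
def aisle (M : C) : ObjectProperty C := additiveClosure fun Y => HasPath M Y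

/-- `add {Z indecomposable | there is no path M ⇝ Z[-1]}`. -/
def coaisle (M : C) : ObjectProperty C :=
  additiveClosure fun Z => Indecomposable Z ∧ ¬ HasPath M (Z⟦(-1 : ℤ)⟧)

lemma additiveClosure_of_iso {P : C → Prop} {X Y : C} (e : X ≅ Y) (h : additiveClosure P X) :
    additiveClosure P Y := by
  obtain ⟨n, Z, hZ, ⟨f⟩⟩ := h
  exact ⟨n, Z, hZ, ⟨e.symm ≪≫ f⟩⟩

instance (P : C → Prop) : (additiveClosure P).IsClosedUnderIsomorphisms where
  of_iso e h := additiveClosure_of_iso e h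

instance (M : C) : (aisle M).IsClosedUnderIsomorphisms := by
  dsimp only [aisle]; infer_instance

instance (M : C) : (coaisle M).IsClosedUnderIsomorphisms := by
  dsimp only [coaisle]; infer_instance

lemma additiveClosure_shift {P Q : C → Prop} (a : ℤ) (h : ∀ Y, P Y → Q (Y⟦a⟧)) {X : C}
    (hX : additiveClosure P X) : additiveClosure Q (X⟦a⟧) := by
  obtain ⟨n, Y, hY, ⟨e⟩⟩ := hX
  exact ⟨n, fun i => (Y i)⟦a⟧, fun i => h _ (hY i),
    ⟨(shiftFunctor C a).mapIso e ≪≫ (shiftFunctor C a).mapBiproduct Y⟩⟩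

lemma hom_eq_zero_of_additiveClosure {P Q : C → Prop}
    (h : ∀ Y Z, P Y → Q Z → ∀ f : Y ⟶ Z, f = 0) {X X' : C} (hX : additiveClosure P X)
    (hX' : additiveClosure Q X') (f : X ⟶ X') : f = 0 := by
  obtain ⟨n, Y, hY, ⟨e⟩⟩ := hX
  obtain ⟨m, Z, hZ, ⟨e'⟩⟩ := hX'
  have : e.inv ≫ f ≫ e'.hom = 0 := by
    ext i j
    simpa using h _ _ (hY j) (hZ i)
      (biproduct.ι Y j ≫ (e.inv ≫ f ≫ e'.hom) ≫ biproduct.π Z i)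
  have h2 : f = e.hom ≫ (e.inv ≫ f ≫ e'.hom) ≫ e'.inv := by simp
  rw [h2, this]; simp

lemma additiveClosure_biproduct {J : Type} [Finite J] {P : C → Prop} (Y : J → C)
    (h : ∀ j, P (Y j)) : additiveClosure P (⨁ Y) := by
  obtain ⟨n, ⟨e⟩⟩ := Finite.exists_equiv_fin J
  exact ⟨n, Y ∘ e.symm, fun i => h _, ⟨(biproduct.reindex e.symm Y).symm⟩⟩

lemma exists_biprod_of_additiveClosure {P : C → Prop} (Q : C → Prop) {X : C}
    (hX : additiveClosure P X) :
    ∃ (A B : C), additiveClosure (fun Y => P Y ∧ Q Y) A ∧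
      additiveClosure (fun Y => P Y ∧ ¬ Q Y) B ∧ Nonempty (A ⊞ B ≅ X) := by
  classical
  obtain ⟨n, Y, hY, ⟨e⟩⟩ := hX
  let p : Fin n → Prop := fun i => Q (Y i)
  let q : Fin n → Prop := fun i => ¬ Q (Y i)
  refine ⟨⨁ Subtype.restrict p Y, ⨁ Subtype.restrict q Y,
    additiveClosure_biproduct _ (fun j => ⟨hY _, j.2⟩),
    additiveClosure_biproduct _ (fun j => ⟨hY _, j.2⟩), ⟨Iso.trans
      { hom := biprod.desc (biproduct.fromSubtype Y p) (biproduct.fromSubtype Y q)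
        inv := biprod.lift (biproduct.toSubtype Y p) (biproduct.toSubtype Y q)
        hom_inv_id := ?_
        inv_hom_id := ?_ } e.symm⟩⟩
  · have hpq : biproduct.fromSubtype Y p ≫ biproduct.toSubtype Y q = 0 :=
      biproduct.hom_ext _ _ fun j => by
        rw [Category.assoc, biproduct.toSubtype_π, zero_comp]
        exact (biproduct.fromSubtype_π Y p j.1).trans (dif_neg j.2)
    have hqp : biproduct.fromSubtype Y q ≫ biproduct.toSubtype Y p = 0 :=
      biproduct.hom_ext _ _ fun j => by
        rw [Category.assoc, biproduct.toSubtype_π, zero_comp]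
        exact (biproduct.fromSubtype_π Y q j.1).trans (dif_neg fun h : q j => h j.2)
    apply biprod.hom_ext' <;> apply biprod.hom_ext
    all_goals simp only [Category.assoc, biprod.inl_desc_assoc, biprod.inr_desc_assoc,
      biprod.lift_fst, biprod.lift_snd, hpq, hqp, biproduct.fromSubtype_toSubtype,
      Category.id_comp, biprod.inl_fst, biprod.inl_snd, biprod.inr_fst, biprod.inr_snd]
  · rw [biprod.lift_desc, biproduct.toSubtype_fromSubtype, biproduct.toSubtype_fromSubtype]
    ext i j
    by_cases hi : Q (Y i) <;> simp [p, q, biproduct.map_π, hi]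

lemma indecomposable_of_iso {X Y : C} (e : X ≅ Y) (hX : Indecomposable X) : Indecomposable Y :=
  ⟨fun h => hX.1 (h.of_iso e), fun A B f => hX.2 A B (e ≪≫ f)⟩

lemma isZero_of_shift {X : C} {n : ℤ} (h : IsZero (X⟦n⟧)) : IsZero X :=
  ((shiftFunctor C (-n)).map_isZero h).of_iso (shiftShiftNeg X n).symm

lemma indecomposable_shift {X : C} (n : ℤ) (hX : Indecomposable X) : Indecomposable (X⟦n⟧) := by
  refine ⟨fun h => hX.1 (isZero_of_shift h), fun A B f => ?_⟩
  have := preservesBinaryBiproducts_of_preservesBiproducts (shiftFunctor C (-n))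
  have e : X ≅ A⟦-n⟧ ⊞ B⟦-n⟧ := (shiftShiftNeg X n).symm ≪≫ (shiftFunctor C (-n)).mapIso f ≪≫
    (shiftFunctor C (-n)).mapBiprod A B
  exact (hX.2 _ _ e).imp isZero_of_shift isZero_of_shift

lemma HasPath.step {X Y Z : C} (h : HasPath X Y) (h' : PathStep Y Z) : HasPath X Z :=
  ⟨h.1, h'.2.1, h.2.2.tail h'⟩

lemma HasPath.of_hom {X Y Z : C} (h : HasPath X Y) (hZ : Indecomposable Z) (f : Y ⟶ Z)
    (hf : f ≠ 0) : HasPath X Z :=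
  h.step ⟨h.2.1, hZ, Or.inl ⟨f, hf⟩⟩

lemma HasPath.of_iso {X Y Z : C} (h : HasPath X Y) (e : Y ≅ Z) : HasPath X Z :=
  h.of_hom (indecomposable_of_iso e h.2.1) e.hom (fun h0 => h.2.1.1 (by
    rw [IsZero.iff_id_eq_zero, ← e.hom_inv_id, h0, zero_comp]))

lemma HasPath.shift {X Y : C} (h : HasPath X Y) : HasPath X (Y⟦(1 : ℤ)⟧) :=
  h.step ⟨h.2.1, indecomposable_shift 1 h.2.1, Or.inr ⟨Iso.refl _⟩⟩

/-- The t-structure `(aisle M, coaisle M)` determined by the object `M`. In degree `n`, its two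
halves are the shifts by `-n` of those in degree `0`. -/
def pathTStructure (hC : HasIndecomposableDecompositions C) (M : C) : TStructure C where
  le n X := aisle M (X⟦n⟧)
  ge n X := coaisle M (X⟦n⟧)
  le_isClosedUnderIsomorphisms n :=
    ⟨fun e h => (aisle M).prop_of_iso ((shiftFunctor C n).mapIso e) h⟩
  ge_isClosedUnderIsomorphisms n :=
    ⟨fun e h => (coaisle M).prop_of_iso ((shiftFunctor C n).mapIso e) h⟩
  le_shift n a n' h X hX := (aisle M).prop_of_iso ((shiftFunctorAdd' C a n' n h).app X) hX
  ge_shift n a n' h X hX := (coaisle M).prop_of_iso ((shiftFunctorAdd' C a n' n h).app X) hX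
  zero' X Y f hX hY := by
    have hX' : aisle M X := (aisle M).prop_of_iso ((shiftFunctorZero C ℤ).app X) hX
    have hY' : additiveClosure (fun Z => Indecomposable Z ∧ ¬ HasPath M Z) Y :=
      additiveClosure_of_iso (shiftShiftNeg Y (1 : ℤ))
        (additiveClosure_shift (-1) (fun Z hZ => ⟨indecomposable_shift _ hZ.1, hZ.2⟩) hY)
    refine hom_eq_zero_of_additiveClosure (fun A B hA hB g => ?_) hX' hY' f
    by_contra hg
    exact hB.2 (HasPath.of_hom hA hB.1 g hg)
  le_zero_le X hX := by
    have hX' : aisle M X := (aisle M).prop_of_iso ((shiftFunctorZero C ℤ).app X) hX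
    exact additiveClosure_shift 1 (fun _ h => h.shift) hX'
  ge_one_le X hX := by
    refine additiveClosure_of_iso (shiftShiftNeg X (1 : ℤ) ≪≫ ((shiftFunctorZero C ℤ).app X).symm)
      (additiveClosure_shift (-1) (fun Z hZ => ⟨indecomposable_shift _ hZ.1, fun h => ?_⟩) hX)
    exact hZ.2 (h.shift.of_iso (shiftNegShift _ (1 : ℤ)))
  exists_triangle_zero_one A := by
    obtain ⟨X, Y, hX, hY, ⟨e⟩⟩ := exists_biprod_of_additiveClosure (HasPath M) (hC A)
    refine ⟨X, Y, ?_, ?_, biprod.inl ≫ e.hom, e.inv ≫ biprod.snd, 0, ?_⟩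
    · refine (aisle M).prop_of_iso ((shiftFunctorZero C ℤ).app X).symm ?_
      obtain ⟨n, Z, hZ, hi⟩ := hX
      exact ⟨n, Z, fun i => (hZ i).2, hi⟩
    · refine additiveClosure_shift 1 (fun Z hZ => ⟨indecomposable_shift _ hZ.1, fun h => ?_⟩) hY
      exact hZ.2 (h.of_iso (shiftShiftNeg Z (1 : ℤ)))
    · refine isomorphic_distinguished _ (binaryBiproductTriangle_distinguished X Y) _
        (Triangle.isoMk _ _ (Iso.refl _) e.symm (Iso.refl _) ?_ ?_ ?_)
      · change (biprod.inl ≫ e.hom) ≫ e.inv = 𝟙 X ≫ biprod.inl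
        simp
      · change (e.inv ≫ biprod.snd) ≫ 𝟙 Y = e.inv ≫ biprod.snd
        simp
      · change (0 : Y ⟶ X⟦(1 : ℤ)⟧) ≫ _ = 𝟙 Y ≫ 0
        exact zero_comp.trans comp_zero.symm

lemma pathTStructure_le_zero (hC : HasIndecomposableDecompositions C) (M X : C) :
    (pathTStructure hC M).le 0 X ↔ aisle M X :=
  (aisle M).prop_iff_of_iso ((shiftFunctorZero C ℤ).app X)

lemma pathTStructure_ge_zero (hC : HasIndecomposableDecompositions C) (M X : C) :
    (pathTStructure hC M).ge 0 X ↔ coaisle M X :=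
  (coaisle M).prop_iff_of_iso ((shiftFunctorZero C ℤ).app X)

/-! ### The heart of a t-structure is abelian -/

section Heart

variable (t : TStructure C)

instance : t.heart.ContainsZero where
  exists_zero := ⟨_, isZero_zero C, by
    rw [t.mem_heart_iff]
    exact ⟨t.isLE_of_isZero (isZero_zero C) 0, t.isGE_of_isZero (isZero_zero C) 0⟩⟩

instance : t.heart.IsClosedUnderBinaryProducts where
  limitsOfShape_le := by
    rintro X ⟨p⟩
    have hl := (t.mem_heart_iff _).1 (p.prop_diag_obj (.mk .left))
    have hr := (t.mem_heart_iff _).1 (p.prop_diag_obj (.mk .right))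
    refine t.heart.prop_of_iso ?_ ((t.mem_heart_iff _).2
      ⟨t.isLE₂ _ (binaryProductTriangle_distinguished _ _) 0 hl.1 hr.1,
        t.isGE₂ _ (binaryProductTriangle_distinguished _ _) 0 hl.2 hr.2⟩)
    exact IsLimit.conePointUniqueUpToIso (prodIsProd _ _)
      ((IsLimit.postcomposeHomEquiv (diagramIsoPair p.diag) _).2 p.isLimit)

instance : t.heart.IsClosedUnderFiniteProducts := .mk'

lemma heart_hom_eq_zero ⦃X Y : t.heart.FullSubcategory⦄ ⦃n : ℤ⦄
    (f : t.heart.ι.obj X ⟶ (t.heart.ι.obj Y)⟦n⟧) (hn : n < 0) : f = 0 := by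
  have hX := ((t.mem_heart_iff _).1 X.property).1
  have hY : t.IsGE (t.heart.ι.obj Y) 0 := ((t.mem_heart_iff _).1 Y.property).2
  exact t.zero_of_isLE_of_isGE f 0 (-n) (by lia) hX (t.isGE_shift _ 0 n (-n) (by lia))

lemma heart_admissible :
    AbelianSubcategory.admissibleMorphism t.heart.ι = ⊤ := by
  ext X₁ X₂ f₁
  simp only [MorphismProperty.top_apply, iff_true]
  intro X₃ f₂ f₃ hT
  have h₁ := (t.mem_heart_iff _).1 X₁.property
  have h₂ := (t.mem_heart_iff _).1 X₂.property
  have h₁l := h₁.1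
  have h₁g := h₁.2
  have hLE : t.IsLE X₃ 0 := by
    refine t.isLE₂ _ (rot_of_distTriang _ hT) 0 h₂.1 ?_
    have := t.isLE_shift X₁.obj 0 1 (-1) (by lia)
    exact t.isLE_of_le (X₁.obj⟦(1 : ℤ)⟧) (-1) 0 (by lia)
  have hGE : t.IsGE X₃ (-1) := by
    refine t.isGE₂ _ (rot_of_distTriang _ hT) (-1) ?_ (t.isGE_shift X₁.obj 0 1 (-1) (by lia))
    have := h₂.2
    exact t.isGE_of_ge X₂.obj (-1) 0 (by lia)
  obtain ⟨K, Q, hK, hQ, α, β, γ, hT'⟩ := t.exists_triangle X₃ (-1) 0 (by lia)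
  have hK₁ : t.IsLE K (-1) := ⟨hK⟩
  have hQ₁ : t.IsGE Q 0 := ⟨hQ⟩
  have hQ₂ : t.IsLE Q 0 := by
    refine t.isLE₂ _ (rot_of_distTriang _ hT') 0 hLE ?_
    have := t.isLE_shift K (-1) 1 (-2) (by lia)
    exact t.isLE_of_le (K⟦(1 : ℤ)⟧) (-2) 0 (by lia)
  have hK₂ : t.IsGE K (-1) := by
    refine t.isGE₂ _ (inv_rot_of_distTriang _ hT') (-1) ?_ hGE
    have := t.isGE_shift Q 0 (-1) 1 (by lia)
    exact t.isGE_of_ge (Q⟦(-1 : ℤ)⟧) (-1) 1 (by lia)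
  let e : K⟦(-1 : ℤ)⟧⟦(1 : ℤ)⟧ ≅ K := shiftNegShift K (1 : ℤ)
  refine ⟨⟨K⟦(-1 : ℤ)⟧, (t.mem_heart_iff _).2
    ⟨t.isLE_shift K (-1) (-1) 0 (by lia), t.isGE_shift K (-1) (-1) 0 (by lia)⟩⟩,
    ⟨Q, (t.mem_heart_iff _).2 ⟨hQ₂, hQ₁⟩⟩, e.hom ≫ α, β, γ ≫ e.inv⟦(1 : ℤ)⟧', ?_⟩
  refine isomorphic_distinguished _ hT' _
    (Triangle.isoMk _ _ e (Iso.refl _) (Iso.refl _) ?_ ?_ ?_)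
  · change (e.hom ≫ α) ≫ 𝟙 X₃ = e.hom ≫ α
    simp
  · change β ≫ 𝟙 Q = 𝟙 X₃ ≫ β
    simp
  · change (γ ≫ e.inv⟦(1 : ℤ)⟧') ≫ e.hom⟦(1 : ℤ)⟧' = 𝟙 Q ≫ γ
    rw [Category.assoc, ← Functor.map_comp, e.inv_hom_id]
    simp

/-- The heart of a t-structure is an abelian category. -/
instance heartAbelian [IsTriangulated C] : Abelian t.heart.FullSubcategory :=
  AbelianSubcategory.abelian t.heart.ι (heart_hom_eq_zero t) (heart_admissible t)

end Heart

end

end PathTriang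

/-! Write `ι` for the inclusion of the heart `H`. Three properties determine a triangulated category
up to triangle equivalence: morphisms of negative degree between objects of `H` vanish and those of
degree one are the extension classes of `H` (`IsHeart`); those of degree at least two vanish
(`Hereditary`); every object is a finite direct sum of shifts of objects of `H` (`Decomposes`). The
proof establishes these properties for `T` and for the bounded derived category of `H`, and then
compares the two.

On the side of `T`, the key is `HasPath.of_hom_shift`: a non-zero `X ⟶ Y` between indecomposables
yields a path from `Y` to `X[1]`. A non-zero morphism of degree at least two in the heart would thus
produce a forbidden path (`hereditary_heart`). The same lemma shows that the indecomposables with a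
shift reachable from `M`, or from which a shift of `M` is reachable, are orthogonal to the others on
both sides; in a block they are therefore all the indecomposables. As there is no path from `M` to
`M[-1]`, the shifts of a given object reachable from `M` are bounded below, and the least one lies
in the heart (`exists_shift_mem_heart`).

On the derived side, products of two extension classes vanish because they do in `T`, and
effaceability carries this to all degrees at least two (`Hereditary.of_effaceable`). Truncation
triangles then split (`additiveClosure_single_shift`).

For the comparison (`IsHeart.triangleEquivalent`), the graded morphisms between heart objects, which
live in degrees 0 and 1, agree on both sides. A Yoneda argument extends this identification to an
equivalence commuting with shifts (`exists_functor`). That it preserves triangles is not formal: it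
holds for triangles of short exact sequences, and triangles on all other morphisms are assembled
from these. Octahedra leave the last morphism of such a triangle undetermined; orthogonality of
summands makes it unique (`Common.of_source_splitting`), so that the construction commutes with the
equivalence. -/

namespace PathTriang

set_option linter.unusedSectionVars false

/-! ### Distinguished triangles given by three morphisms -/

section Dist

variable {C : Type*} [Category* C] [Preadditive C] [HasZeroObject C] [HasShift C ℤ]
  [∀ n : ℤ, (shiftFunctor C n).Additive] [Pretriangulated C]

/-- The triangle with morphisms `f`, `g`, `h` is distinguished. -/
def Dist {X Y Z : C} (f : X ⟶ Y) (g : Y ⟶ Z) (h : Z ⟶ X⟦(1 : ℤ)⟧) : Prop :=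
  Triangle.mk f g h ∈ distTriang C

/-- A decomposition of `X` as the direct sum of `X₁` and `X₂`. -/
structure Splitting (X₁ X₂ X : C) where
  inl : X₁ ⟶ X
  inr : X₂ ⟶ X
  fst : X ⟶ X₁
  snd : X ⟶ X₂
  inl_fst : inl ≫ fst = 𝟙 X₁
  inr_snd : inr ≫ snd = 𝟙 X₂
  inl_snd : inl ≫ snd = 0
  inr_fst : inr ≫ fst = 0
  total : fst ≫ inl + snd ≫ inr = 𝟙 X

attribute [simp] Splitting.inl_fst Splitting.inr_snd Splitting.inl_snd Splitting.inr_fst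

namespace Splitting

section

variable {X₁ X₂ X : C} (s : Splitting X₁ X₂ X)

@[simp]
lemma inl_fst_assoc {Y : C} (f : X₁ ⟶ Y) : s.inl ≫ s.fst ≫ f = f := by
  rw [← Category.assoc, s.inl_fst, Category.id_comp]

@[simp]
lemma inr_snd_assoc {Y : C} (f : X₂ ⟶ Y) : s.inr ≫ s.snd ≫ f = f := by
  rw [← Category.assoc, s.inr_snd, Category.id_comp]

@[simp]
lemma inl_snd_assoc {Y : C} (f : X₂ ⟶ Y) : s.inl ≫ s.snd ≫ f = 0 := by
  rw [← Category.assoc, s.inl_snd, zero_comp]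

@[simp]
lemma inr_fst_assoc {Y : C} (f : X₁ ⟶ Y) : s.inr ≫ s.fst ≫ f = 0 := by
  rw [← Category.assoc, s.inr_fst, zero_comp]

end

/-- The splitting of a binary biproduct. -/
noncomputable def biprod (X₁ X₂ : C) : Splitting X₁ X₂ (X₁ ⊞ X₂) where
  inl := biprod.inl
  inr := biprod.inr
  fst := biprod.fst
  snd := biprod.snd
  inl_fst := by simp
  inr_snd := by simp
  inl_snd := by simp
  inr_fst := by simp
  total := by simp

variable {X₁ X₂ X : C}

/-- Transport of a splitting along an isomorphism. -/
def ofIso (s : Splitting X₁ X₂ X) {Y : C} (e : X ≅ Y) : Splitting X₁ X₂ Y where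
  inl := s.inl ≫ e.hom
  inr := s.inr ≫ e.hom
  fst := e.inv ≫ s.fst
  snd := e.inv ≫ s.snd
  inl_fst := by simp
  inr_snd := by simp
  inl_snd := by simp
  inr_fst := by simp
  total := by
    have := s.total
    rw [← cancel_mono e.inv, ← cancel_epi e.hom]
    simpa using this

/-- The splitting with the two summands exchanged. -/
def symm (s : Splitting X₁ X₂ X) : Splitting X₂ X₁ X where
  inl := s.inr
  inr := s.inl
  fst := s.snd
  snd := s.fst
  inl_fst := s.inr_snd
  inr_snd := s.inl_fst
  inl_snd := s.inr_fst
  inr_fst := s.inl_snd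
  total := by rw [add_comm]; exact s.total

/-- The image of a splitting under an additive functor. -/
def map (s : Splitting X₁ X₂ X) {D : Type*} [Category* D] [Preadditive D] [HasZeroObject D]
    [HasShift D ℤ] [∀ n : ℤ, (shiftFunctor D n).Additive] [Pretriangulated D]
    (F : C ⥤ D) [F.Additive] : Splitting (F.obj X₁) (F.obj X₂) (F.obj X) where
  inl := F.map s.inl
  inr := F.map s.inr
  fst := F.map s.fst
  snd := F.map s.snd
  inl_fst := by rw [← F.map_comp, s.inl_fst, F.map_id]
  inr_snd := by rw [← F.map_comp, s.inr_snd, F.map_id]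
  inl_snd := by rw [← F.map_comp, s.inl_snd, F.map_zero]
  inr_fst := by rw [← F.map_comp, s.inr_fst, F.map_zero]
  total := by rw [← F.map_comp, ← F.map_comp, ← F.map_add, s.total, F.map_id]

lemma hom_ext (s : Splitting X₁ X₂ X) {Y : C} {f g : X ⟶ Y} (h₁ : s.inl ≫ f = s.inl ≫ g)
    (h₂ : s.inr ≫ f = s.inr ≫ g) : f = g := by
  rw [← Category.id_comp f, ← Category.id_comp g, ← s.total]
  simp [h₁, h₂]

lemma hom_ext' (s : Splitting X₁ X₂ X) {Y : C} {f g : Y ⟶ X} (h₁ : f ≫ s.fst = g ≫ s.fst)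
    (h₂ : f ≫ s.snd = g ≫ s.snd) : f = g := by
  rw [← Category.comp_id f, ← Category.comp_id g, ← s.total, Preadditive.comp_add,
    Preadditive.comp_add, reassoc_of% h₁, reassoc_of% h₂]

end Splitting

namespace Dist

variable {X Y Z : C} {f : X ⟶ Y} {g : Y ⟶ Z} {h : Z ⟶ X⟦(1 : ℤ)⟧}

lemma comp₁₂ (H : Dist f g h) : f ≫ g = 0 := comp_distTriang_mor_zero₁₂ _ H

lemma comp₂₃ (H : Dist f g h) : g ≫ h = 0 := comp_distTriang_mor_zero₂₃ _ H

lemma comp₃₁ (H : Dist f g h) : h ≫ f⟦(1 : ℤ)⟧' = 0 := comp_distTriang_mor_zero₃₁ _ H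

lemma rot (H : Dist f g h) : Dist g h (-f⟦(1 : ℤ)⟧') := rot_of_distTriang _ H

lemma rot_iff : Dist f g h ↔ Dist g h (-f⟦(1 : ℤ)⟧') := rotate_distinguished_triangle _

lemma exists_cone (f : X ⟶ Y) : ∃ (Z : C) (g : Y ⟶ Z) (h : Z ⟶ X⟦(1 : ℤ)⟧), Dist f g h :=
  distinguished_cocone_triangle f

lemma exists_middle (h : Z ⟶ X⟦(1 : ℤ)⟧) : ∃ (Y : C) (f : X ⟶ Y) (g : Y ⟶ Z), Dist f g h :=
  distinguished_cocone_triangle₂ h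

lemma desc₃ (H : Dist f g h) {W : C} (k : Z ⟶ W) (hk : g ≫ k = 0) :
    ∃ l : X⟦(1 : ℤ)⟧ ⟶ W, k = h ≫ l :=
  Triangle.yoneda_exact₃ _ H k hk

lemma lift₂ (H : Dist f g h) {W : C} (k : W ⟶ Y) (hk : k ≫ g = 0) : ∃ l : W ⟶ X, k = l ≫ f :=
  Triangle.coyoneda_exact₂ _ H k hk

lemma lift₃ (H : Dist f g h) {W : C} (k : W ⟶ Z) (hk : k ≫ h = 0) : ∃ l : W ⟶ Y, k = l ≫ g :=
  Triangle.coyoneda_exact₃ _ H k hk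

lemma lift₁ (H : Dist f g h) {W : C} (k : W ⟶ X⟦(1 : ℤ)⟧) (hk : k ≫ f⟦(1 : ℤ)⟧' = 0) :
    ∃ l : W ⟶ Z, k = l ≫ h :=
  Triangle.coyoneda_exact₁ _ H k hk

lemma of_iso (H : Dist f g h) {X' Y' Z' : C} {f' : X' ⟶ Y'} {g' : Y' ⟶ Z'}
    {h' : Z' ⟶ X'⟦(1 : ℤ)⟧} (a : X' ≅ X) (b : Y' ≅ Y) (c : Z' ≅ Z)
    (h₁ : f' ≫ b.hom = a.hom ≫ f) (h₂ : g' ≫ c.hom = b.hom ≫ g)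
    (h₃ : h' ≫ a.hom⟦(1 : ℤ)⟧' = c.hom ≫ h) : Dist f' g' h' :=
  isomorphic_distinguished _ H _ (Triangle.isoMk _ _ a b c h₁ h₂ h₃)

lemma neg₁₂ (H : Dist f g h) : Dist (-f) (-g) h :=
  H.of_iso (Iso.refl _) (-(Iso.refl _)) (Iso.refl _) (by simp) (by simp) (by simp)

lemma exists_hom₃ (H : Dist f g h) {X' Y' Z' : C} {f' : X' ⟶ Y'} {g' : Y' ⟶ Z'}
    {h' : Z' ⟶ X'⟦(1 : ℤ)⟧} (H' : Dist f' g' h') (a : X ⟶ X') (b : Y ⟶ Y')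
    (comm : f ≫ b = a ≫ f') : ∃ c : Z ⟶ Z', g ≫ c = b ≫ g' ∧ h ≫ a⟦(1 : ℤ)⟧' = c ≫ h' :=
  complete_distinguished_triangle_morphism _ _ H H' a b comm

lemma exists_hom₂ (H : Dist f g h) {X' Y' Z' : C} {f' : X' ⟶ Y'} {g' : Y' ⟶ Z'}
    {h' : Z' ⟶ X'⟦(1 : ℤ)⟧} (H' : Dist f' g' h') (a : X ⟶ X') (c : Z ⟶ Z')
    (comm : h ≫ a⟦(1 : ℤ)⟧' = c ≫ h') : ∃ b : Y ⟶ Y', f ≫ b = a ≫ f' ∧ g ≫ c = b ≫ g' :=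
  complete_distinguished_triangle_morphism₂ _ _ H H' a c comm

lemma exists_iso₃ (H : Dist f g h) {X' Y' Z' : C} {f' : X' ⟶ Y'} {g' : Y' ⟶ Z'}
    {h' : Z' ⟶ X'⟦(1 : ℤ)⟧} (H' : Dist f' g' h') (a : X ≅ X') (b : Y ≅ Y')
    (comm : f ≫ b.hom = a.hom ≫ f') :
    ∃ c : Z ≅ Z', g ≫ c.hom = b.hom ≫ g' ∧ h ≫ a.hom⟦(1 : ℤ)⟧' = c.hom ≫ h' := by
  obtain ⟨c, h₁, h₂⟩ := H.exists_hom₃ H' a.hom b.hom comm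
  have : IsIso c := isIso₃_of_isIso₁₂ (T := Triangle.mk f g h) (T' := Triangle.mk f' g' h')
    { hom₁ := a.hom, hom₂ := b.hom, hom₃ := c, comm₁ := comm, comm₂ := h₁, comm₃ := h₂ } H H'
    (inferInstanceAs (IsIso a.hom)) (inferInstanceAs (IsIso b.hom))
  exact ⟨asIso c, h₁, h₂⟩

lemma isIso₂ (H : Dist f g h) {X' Y' Z' : C} {f' : X' ⟶ Y'} {g' : Y' ⟶ Z'}
    {h' : Z' ⟶ X'⟦(1 : ℤ)⟧} (H' : Dist f' g' h') (a : X ≅ X') (b : Y ⟶ Y') (c : Z ≅ Z')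
    (h₁ : f ≫ b = a.hom ≫ f') (h₂ : g ≫ c.hom = b ≫ g')
    (h₃ : h ≫ a.hom⟦(1 : ℤ)⟧' = c.hom ≫ h') : IsIso b :=
  isIso₂_of_isIso₁₃ (T := Triangle.mk f g h) (T' := Triangle.mk f' g' h')
    { hom₁ := a.hom, hom₂ := b, hom₃ := c.hom, comm₁ := h₁, comm₂ := h₂, comm₃ := h₃ } H H'
    (inferInstanceAs (IsIso a.hom)) (inferInstanceAs (IsIso c.hom))

lemma shift_one (H : Dist f g h) : Dist (f⟦(1 : ℤ)⟧') (g⟦(1 : ℤ)⟧') (-h⟦(1 : ℤ)⟧') := by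
  simpa using H.rot.rot.rot.neg₁₂

end Dist

lemma Splitting.dist {X₁ X₂ X : C} (s : Splitting X₁ X₂ X) : Dist s.inl s.snd 0 := by
  refine Dist.of_iso (X := X₁) (Z := X₂) (binaryBiproductTriangle_distinguished X₁ X₂) (Iso.refl _)
    ⟨biprod.lift s.fst s.snd, biprod.desc s.inl s.inr, ?_, ?_⟩ (Iso.refl _) ?_ ?_ ?_
  · simpa using s.total
  · apply biprod.hom_ext' <;> apply biprod.hom_ext <;> simp
  · apply biprod.hom_ext <;> simp
  · simp
  · exact zero_comp.trans comp_zero.symm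

/-- If `X = X₁ ⊕ X₂`, then a cone of `X ⟶ Y` can be computed by taking the cone `W` of the first
component, and then the cone of the induced morphism `X₂ ⟶ W`. -/
lemma Dist.exists_of_source_splitting [IsTriangulated C] {X₁ X₂ X Y W Z : C} (s : Splitting X₁ X₂ X)
    {f : X ⟶ Y} {α : Y ⟶ W} {β : W ⟶ X₁⟦(1 : ℤ)⟧} (H₁ : Dist (s.inl ≫ f) α β)
    {p : W ⟶ Z} {r : Z ⟶ X₂⟦(1 : ℤ)⟧} (H₂ : Dist ((s.inr ≫ f) ≫ α) p r) :
    ∃ γ : Z ⟶ X⟦(1 : ℤ)⟧, Dist f (α ≫ p) γ ∧ p ≫ γ = β ≫ s.inl⟦(1 : ℤ)⟧' ∧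
      γ ≫ s.snd⟦(1 : ℤ)⟧' = r := by
  obtain ⟨Z₀, g₀, h₀, H₀⟩ := Dist.exists_cone f
  -- Octahedron on `X₁ ⟶ X ⟶ Y`, the first morphism having cone `X₂`.
  have o := someOctahedron rfl s.dist H₀ H₁
  have hm : o.m₁ = (s.inr ≫ f) ≫ α := by
    have := o.comm₁
    rw [Category.assoc, ← this, s.inr_snd_assoc]
  have H₃ : Dist o.m₁ o.m₃ (h₀ ≫ s.snd⟦(1 : ℤ)⟧') := o.mem
  obtain ⟨e, h₁, h₂⟩ := H₃.exists_iso₃ H₂ (Iso.refl _) (Iso.refl _) (by simp [hm])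
  have h₁' : o.m₃ ≫ e.hom = p := by simpa using h₁
  have h₂' : h₀ ≫ s.snd⟦(1 : ℤ)⟧' = e.hom ≫ r := by simpa using h₂
  refine ⟨e.inv ≫ h₀, ?_, ?_, ?_⟩
  · refine H₀.of_iso (Iso.refl _) (Iso.refl _) e.symm (by simp) ?_ (by simp)
    have := o.comm₃
    simp [← h₁', this]
  · have := o.comm₄
    rw [← h₁']
    simp [this]
  · simp [h₂']

/-- Adding a direct summand to the target of a morphism adds it to the cone. -/
lemma Dist.add_target_summand [IsTriangulated C] {X Y₁ R Y Z₁ Z : C} {f : X ⟶ Y₁} {α : Y₁ ⟶ Z₁}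
    {β : Z₁ ⟶ X⟦(1 : ℤ)⟧} (H : Dist f α β) (s : Splitting Y₁ R Y) (t : Splitting Z₁ R Z) :
    Dist (f ≫ s.inl) (s.fst ≫ α ≫ t.inl + s.snd ≫ t.inr) (t.fst ≫ β) := by
  obtain ⟨Z₀, g₀, h₀, H₀⟩ := Dist.exists_cone (f ≫ s.inl)
  have o := someOctahedron rfl H s.dist H₀
  have H₃ : Dist o.m₁ o.m₃ ((0 : R ⟶ Y₁⟦(1 : ℤ)⟧) ≫ α⟦(1 : ℤ)⟧') := o.mem
  -- In the octahedron on `X ⟶ Y₁ ⟶ Y`, the triangle on the cones `Z₁`, `Z₀`, `R` has zero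
  -- connecting morphism, hence splits.
  rw [zero_comp] at H₃
  have c₁ := o.comm₁
  have c₂ := o.comm₂
  have c₃ := o.comm₃
  have e₁ := t.dist.isIso₂ H₃ (Iso.refl _) (t.fst ≫ o.m₁ + t.snd ≫ s.inr ≫ g₀) (Iso.refl _)
    (by simp) (by simp [H₃.comp₁₂, c₃]) (by simp)
  refine H₀.of_iso (Iso.refl _) (Iso.refl _) (asIso (t.fst ≫ o.m₁ + t.snd ≫ s.inr ≫ g₀))
    (by simp) ?_ ?_
  · apply s.hom_ext
    · simp [c₁]
    · simp
  · apply t.hom_ext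
    · simp [c₂]
    · have : g₀ ≫ h₀ = 0 := H₀.comp₂₃
      simp [this]

end Dist

/-! ### Distinguished triangles with distinguished image -/

section Common

variable {C D : Type*} [Category* C] [Category* D] [Preadditive C] [Preadditive D]
  [HasZeroObject C] [HasZeroObject D] [HasShift C ℤ] [HasShift D ℤ]
  [∀ n : ℤ, (shiftFunctor C n).Additive] [∀ n : ℤ, (shiftFunctor D n).Additive]
  [Pretriangulated C] [Pretriangulated D]
  (F : C ⥤ D) [F.CommShift ℤ] [F.Additive]

/-- The triangle with morphisms `f`, `g`, `h` is distinguished, and so is its image under `F`. -/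
def Common {X Y Z : C} (f : X ⟶ Y) (g : Y ⟶ Z) (h : Z ⟶ X⟦(1 : ℤ)⟧) : Prop :=
  Dist f g h ∧ Dist (F.map f) (F.map g) (F.map h ≫ (F.commShiftIso (1 : ℤ)).hom.app X)

/-- The morphism `f` can be completed to a distinguished triangle whose image under `F` is
distinguished. -/
def Good {X Y : C} (f : X ⟶ Y) : Prop :=
  ∃ (Z : C) (g : Y ⟶ Z) (h : Z ⟶ X⟦(1 : ℤ)⟧), Common F f g h

variable {F}

namespace Common

variable {X Y Z : C} {f : X ⟶ Y} {g : Y ⟶ Z} {h : Z ⟶ X⟦(1 : ℤ)⟧}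

lemma good (H : Common F f g h) : Good F f := ⟨_, _, _, H⟩

lemma rot_map_iff : Dist (F.map f) (F.map g) (F.map h ≫ (F.commShiftIso (1 : ℤ)).hom.app X) ↔
    Dist (F.map g) (F.map h) (F.map (-f⟦(1 : ℤ)⟧') ≫ (F.commShiftIso (1 : ℤ)).hom.app Y) := by
  rw [Dist.rot_iff]
  have nat := F.commShiftIso_hom_naturality f (1 : ℤ)
  constructor
  · intro H
    refine H.of_iso (Iso.refl _) (Iso.refl _) ((F.commShiftIso (1 : ℤ)).app X) (by simp)
      (by simp) ?_
    rw [Iso.refl_hom, CategoryTheory.Functor.map_id, Category.comp_id, F.map_neg, Preadditive.neg_comp, nat]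
    exact (Preadditive.comp_neg _ _).symm
  · intro H
    refine H.of_iso (Iso.refl _) (Iso.refl _) ((F.commShiftIso (1 : ℤ)).symm.app X) (by simp)
      (by simp) ?_
    rw [Iso.refl_hom, CategoryTheory.Functor.map_id, Category.comp_id, F.map_neg, Preadditive.neg_comp, nat,
      Preadditive.comp_neg]
    exact congrArg Neg.neg (((F.commShiftIso (1 : ℤ)).app X).inv_hom_id_assoc _).symm

lemma rot (H : Common F f g h) : Common F g h (-f⟦(1 : ℤ)⟧') :=
  ⟨H.1.rot, rot_map_iff.1 H.2⟩

lemma of_rot (H : Common F g h (-f⟦(1 : ℤ)⟧')) : Common F f g h :=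
  ⟨Dist.rot_iff.2 H.1, rot_map_iff.2 H.2⟩

lemma of_iso (H : Common F f g h) {X' Y' Z' : C} {f' : X' ⟶ Y'} {g' : Y' ⟶ Z'}
    {h' : Z' ⟶ X'⟦(1 : ℤ)⟧} (a : X' ≅ X) (b : Y' ≅ Y) (c : Z' ≅ Z)
    (h₁ : f' ≫ b.hom = a.hom ≫ f) (h₂ : g' ≫ c.hom = b.hom ≫ g)
    (h₃ : h' ≫ a.hom⟦(1 : ℤ)⟧' = c.hom ≫ h) : Common F f' g' h' := by
  refine ⟨H.1.of_iso a b c h₁ h₂ h₃, H.2.of_iso (F.mapIso a) (F.mapIso b) (F.mapIso c) ?_ ?_ ?_⟩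
  · rw [Functor.mapIso_hom, Functor.mapIso_hom, ← F.map_comp, h₁, F.map_comp]
  · rw [Functor.mapIso_hom, Functor.mapIso_hom, ← F.map_comp, h₂, F.map_comp]
  · have := F.commShiftIso_hom_naturality a.hom (1 : ℤ)
    simp only [Functor.mapIso_hom, Category.assoc]
    rw [← this, ← Category.assoc, ← Category.assoc, ← F.map_comp, ← F.map_comp, h₃]

lemma neg₁₂ (H : Common F f g h) : Common F (-f) (-g) h :=
  H.of_iso (Iso.refl _) (-(Iso.refl _)) (Iso.refl _) (by simp) (by simp) (by simp)

end Common

lemma Good.of_iso {X Y X' Y' : C} {f : X ⟶ Y} (H : Good F f) (a : X' ≅ X) (b : Y' ≅ Y)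
    {f' : X' ⟶ Y'} (h₁ : f' ≫ b.hom = a.hom ≫ f) : Good F f' := by
  obtain ⟨Z, g, h, H⟩ := H
  exact ⟨Z, b.hom ≫ g, h ≫ a.inv⟦(1 : ℤ)⟧', H.of_iso a b (Iso.refl _) h₁ (by simp)
    (by simp [← Functor.map_comp])⟩

/-- Three rotations amount to a shift up to signs, and two of the three signs can be removed by an
isomorphism. -/
lemma good_shift_one_iff {X Y : C} (f : X ⟶ Y) : Good F (f⟦(1 : ℤ)⟧') ↔ Good F f := by
  constructor
  · rintro ⟨Z, g, h, H⟩
    obtain ⟨g', hg'⟩ : ∃ g' : Y ⟶ Z⟦(-1 : ℤ)⟧,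
        g'⟦(1 : ℤ)⟧' = g ≫ (shiftNegShift Z (1 : ℤ)).inv := (shiftFunctor C (1 : ℤ)).map_surjective _
    obtain ⟨h', hh'⟩ : ∃ h' : Z⟦(-1 : ℤ)⟧ ⟶ X⟦(1 : ℤ)⟧,
        h'⟦(1 : ℤ)⟧' = (shiftNegShift Z (1 : ℤ)).hom ≫ h := (shiftFunctor C (1 : ℤ)).map_surjective _
    refine ⟨_, g', -h', Common.of_rot (Common.of_rot (Common.of_rot ?_))⟩
    refine H.neg₁₂.of_iso (Iso.refl _) (Iso.refl _) (shiftNegShift Z (1 : ℤ)) (by simp) ?_ ?_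
    · rw [hg', Preadditive.neg_comp, Category.assoc]
      rw [Iso.inv_hom_id]
      simp
    · simp [hh']
  · rintro ⟨Z, g, h, H⟩
    exact ⟨_, _, _, H.rot.rot.rot.neg₁₂.of_iso (Iso.refl _) (Iso.refl _) (Iso.refl _)
      (f' := f⟦(1 : ℤ)⟧') (g' := g⟦(1 : ℤ)⟧') (h' := -h⟦(1 : ℤ)⟧') (by simp) (by simp) (by simp)⟩

lemma Good.shift {X Y : C} {f : X ⟶ Y} (H : Good F f) (n : ℤ) : Good F (f⟦n⟧') := by
  have hneg : ∀ {X Y : C} {f : X ⟶ Y}, Good F f → Good F (f⟦(-1 : ℤ)⟧') := by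
    intro X Y f H
    rw [← good_shift_one_iff]
    exact H.of_iso (shiftNegShift X (1 : ℤ)) (shiftNegShift Y (1 : ℤ))
      ((shiftFunctorCompIsoId C (-1 : ℤ) 1 (by simp)).hom.naturality f)
  have hadd : ∀ {X Y : C} {f : X ⟶ Y} {a b c : ℤ}, a + b = c → Good F ((f⟦a⟧')⟦b⟧') →
      Good F (f⟦c⟧') := by
    intro X Y f a b c hc H
    exact H.of_iso ((shiftFunctorAdd' C a b c hc).app X) ((shiftFunctorAdd' C a b c hc).app Y)
      ((shiftFunctorAdd' C a b c hc).hom.naturality f)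
  have h0 : Good F (f⟦(0 : ℤ)⟧') := H.of_iso ((shiftFunctorZero C ℤ).app X)
    ((shiftFunctorZero C ℤ).app Y) ((shiftFunctorZero C ℤ).hom.naturality f)
  induction n using Int.induction_on with
  | zero => exact h0
  | succ n hn => exact hadd rfl ((good_shift_one_iff _).2 hn)
  | pred n hn => exact hadd (by lia) (hneg hn)

lemma Good.of_shift {X Y : C} {f : X ⟶ Y} {n : ℤ} (H : Good F (f⟦n⟧')) : Good F f :=
  (H.shift (-n)).of_iso ((shiftFunctorCompIsoId C n (-n) (by simp)).symm.app X)
    ((shiftFunctorCompIsoId C n (-n) (by simp)).symm.app Y)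
    ((shiftFunctorCompIsoId C n (-n) (by simp)).inv.naturality f)

/-- If `X = X₁ ⊕ X₂` with `Hom(X₂, X₁) = 0`, then a triangle on `X ⟶ Y` built from a triangle on
`X₁ ⟶ Y` with cone `W` and a triangle on `X₂ ⟶ W` is unique. -/
lemma Common.of_source_splitting [IsTriangulated C] [IsTriangulated D] [F.Full] [F.Faithful]
    {X₁ X₂ X Y W Z : C} (s : Splitting X₁ X₂ X) (hX : ∀ φ : X₂ ⟶ X₁, φ = 0)
    {f : X ⟶ Y} {α : Y ⟶ W} {β : W ⟶ X₁⟦(1 : ℤ)⟧} (H₁ : Common F (s.inl ≫ f) α β)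
    {p : W ⟶ Z} {r : Z ⟶ X₂⟦(1 : ℤ)⟧} (H₂ : Common F ((s.inr ≫ f) ≫ α) p r) :
    ∃ γ : Z ⟶ X⟦(1 : ℤ)⟧, Common F f (α ≫ p) γ ∧ p ≫ γ = β ≫ s.inl⟦(1 : ℤ)⟧' ∧
      γ ≫ s.snd⟦(1 : ℤ)⟧' = r := by
  obtain ⟨γ, h₁, h₂, h₃⟩ := Dist.exists_of_source_splitting s H₁.1 H₂.1
  refine ⟨γ, ⟨h₁, ?_⟩, h₂, h₃⟩
  obtain ⟨δ, k₁, k₂, k₃⟩ := Dist.exists_of_source_splitting (s.map F) (f := F.map f)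
    (α := F.map α) (β := F.map β ≫ (F.commShiftIso (1 : ℤ)).hom.app X₁)
    (by have := H₁.2; rw [F.map_comp] at this; exact this)
    (p := F.map p) (r := F.map r ≫ (F.commShiftIso (1 : ℤ)).hom.app X₂)
    (by have := H₂.2; rw [F.map_comp, F.map_comp] at this; exact this)
  -- The same construction in `D` gives its own third morphism `δ`, which comes from `C` since `F`
  -- is full. It remains to identify it with `γ`.
  obtain ⟨δ', hδ'⟩ := F.map_surjective (δ ≫ (F.commShiftIso (1 : ℤ)).inv.app X)
  have hδ : δ = F.map δ' ≫ (F.commShiftIso (1 : ℤ)).hom.app X := by simp [hδ']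
  subst hδ
  have nat₁ := F.commShiftIso_hom_naturality s.inl (1 : ℤ)
  have nat₂ := F.commShiftIso_hom_naturality s.snd (1 : ℤ)
  have k₂' : p ≫ δ' = β ≫ s.inl⟦(1 : ℤ)⟧' := by
    apply F.map_injective
    rw [← cancel_mono ((F.commShiftIso (1 : ℤ)).hom.app X)]
    simp only [F.map_comp, Category.assoc]
    rw [k₂, nat₁, Category.assoc]
    rfl
  have k₃' : δ' ≫ s.snd⟦(1 : ℤ)⟧' = r := by
    apply F.map_injective
    rw [← cancel_mono ((F.commShiftIso (1 : ℤ)).hom.app X₂), ← k₃]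
    simp only [F.map_comp, Category.assoc]
    rw [nat₂]
    rfl
  have key : γ = δ' := by
    -- Both morphisms have the same composite with `p`, so their difference factors through `X₂[1]`;
    -- its component in `X₁[1]` vanishes by orthogonality, and that in `X₂[1]` because both
    -- components equal `r`.
    obtain ⟨v, hv⟩ := H₂.1.desc₃ (γ - δ') (by rw [Preadditive.comp_sub, h₂, k₂', sub_self])
    obtain ⟨φ, hφ⟩ : ∃ φ : X₂ ⟶ X₁, φ⟦(1 : ℤ)⟧' = v ≫ s.fst⟦(1 : ℤ)⟧' :=
      (shiftFunctor C (1 : ℤ)).map_surjective _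
    rw [hX φ, Functor.map_zero] at hφ
    rw [← sub_eq_zero]
    apply (s.map (shiftFunctor C (1 : ℤ))).hom_ext'
    · change (γ - δ') ≫ s.fst⟦(1 : ℤ)⟧' = 0 ≫ s.fst⟦(1 : ℤ)⟧'
      rw [hv, Category.assoc, ← hφ, comp_zero, zero_comp]
    · change (γ - δ') ≫ s.snd⟦(1 : ℤ)⟧' = 0 ≫ s.snd⟦(1 : ℤ)⟧'
      rw [Preadditive.sub_comp, h₃, k₃', sub_self, zero_comp]
  subst key
  rw [F.map_comp]
  exact k₁

/-- The cone `W` of the first component is not under control, whence the assumption on all morphisms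
out of `X₂`. -/
lemma Good.of_source_splitting [IsTriangulated C] [IsTriangulated D] [F.Full] [F.Faithful]
    {X₁ X₂ X Y : C} (s : Splitting X₁ X₂ X) (hX : ∀ φ : X₂ ⟶ X₁, φ = 0)
    (f : X ⟶ Y) (H₁ : Good F (s.inl ≫ f)) (H₂ : ∀ {W : C} (g : X₂ ⟶ W), Good F g) : Good F f := by
  obtain ⟨W, α, β, H₁⟩ := H₁
  obtain ⟨Z, p, r, H₂⟩ := H₂ ((s.inr ≫ f) ≫ α)
  obtain ⟨γ, h, -⟩ := Common.of_source_splitting s hX H₁ H₂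
  exact h.good

/-- If `Y = Y₁ ⊕ Y₂` with `Hom(Y₁, Y₂) = 0`, then a morphism `X ⟶ Y` is good if its first component
is, and the restriction of the second component to a fibre of the first one. -/
lemma Good.of_target_splitting [IsTriangulated C] [IsTriangulated D] [F.Full] [F.Faithful]
    {W X Y₁ Y₂ Y : C} (s : Splitting Y₁ Y₂ Y) (hY : ∀ φ : Y₁ ⟶ Y₂, φ = 0) (f : X ⟶ Y)
    {i : W ⟶ X} {c : Y₁ ⟶ W⟦(1 : ℤ)⟧} (H₁ : Common F i (f ≫ s.fst) c)
    (H₂ : Good F (i ≫ f ≫ s.snd)) : Good F f := by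
  obtain ⟨Z, p, r, H₂⟩ := H₂
  -- The second morphism `Y ⟶ Z` of the desired triangle will have components `a` and `p`. Its cone
  -- is computed by the source splitting `Y = Y₂ ⊕ Y₁`: the cone of `p` is `W[1]`, and that of `a ≫
  -- r = -c` is `X[1]`.
  obtain ⟨a, ha⟩ := H₂.1.lift₁ (-c) (by
    rw [Functor.map_comp, Preadditive.neg_comp, ← Category.assoc, H₁.1.comp₃₁, zero_comp, neg_zero])
  obtain ⟨γ, h₁, h₂, h₃⟩ := Common.of_source_splitting s.symm hY
    (f := s.fst ≫ a + s.snd ≫ p) (α := r) (β := -(i ≫ f ≫ s.snd)⟦(1 : ℤ)⟧')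
    (by
      have : s.symm.inl ≫ (s.fst ≫ a + s.snd ≫ p) = p := by
        change s.inr ≫ (s.fst ≫ a + s.snd ≫ p) = p
        simp
      rw [this]
      exact H₂.rot)
    (p := i⟦(1 : ℤ)⟧') (r := -(f ≫ s.fst)⟦(1 : ℤ)⟧') (by
      have : (s.symm.inr ≫ (s.fst ≫ a + s.snd ≫ p)) ≫ r = -c := by
        change (s.inl ≫ (s.fst ≫ a + s.snd ≫ p)) ≫ r = -c
        simp [← ha]
      rw [this]
      simpa using H₁.rot.rot.neg₁₂)
  -- The component in `Y₁[1]` is prescribed. In `Y₂[1]` the two sides agree on `W[1]`, so they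
  -- differ by a morphism factoring through `Y₁[1] ⟶ Y₂[1]`, which is zero. Rotating back then gives
  -- a triangle on `f`.
  have hγ : γ = -f⟦(1 : ℤ)⟧' := by
    have h₂' : i⟦(1 : ℤ)⟧' ≫ γ = (-(i ≫ f ≫ s.snd)⟦(1 : ℤ)⟧') ≫ s.inr⟦(1 : ℤ)⟧' := h₂
    have h₃' : γ ≫ s.fst⟦(1 : ℤ)⟧' = -(f ≫ s.fst)⟦(1 : ℤ)⟧' := h₃
    obtain ⟨l, hl⟩ := H₁.1.rot.rot.desc₃ (γ ≫ s.snd⟦(1 : ℤ)⟧' + (f ≫ s.snd)⟦(1 : ℤ)⟧') (by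
      rw [Preadditive.neg_comp, Preadditive.comp_add, ← Category.assoc, h₂', Category.assoc,
        ← Functor.map_comp, ← Functor.map_comp, s.inr_snd]
      simp)
    obtain ⟨φ, hφ⟩ : ∃ φ : Y₁ ⟶ Y₂, φ⟦(1 : ℤ)⟧' = l := (shiftFunctor C (1 : ℤ)).map_surjective _
    rw [hY φ, Functor.map_zero] at hφ
    apply (s.map (shiftFunctor C (1 : ℤ))).hom_ext'
    · change γ ≫ s.fst⟦(1 : ℤ)⟧' = (-f⟦(1 : ℤ)⟧') ≫ s.fst⟦(1 : ℤ)⟧'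
      rw [h₃', Preadditive.neg_comp, Functor.map_comp]
    · change γ ≫ s.snd⟦(1 : ℤ)⟧' = (-f⟦(1 : ℤ)⟧') ≫ s.snd⟦(1 : ℤ)⟧'
      rw [← hφ, comp_zero, Functor.map_comp] at hl
      rw [Preadditive.neg_comp]
      exact eq_neg_of_add_eq_zero_left hl
  exact ⟨_, _, _, Common.of_rot (hγ ▸ h₁)⟩

/-- The enlarged triangle is given by explicit formulas, which `F` preserves; no orthogonality is
needed here. -/
lemma Good.add_target_summand [IsTriangulated C] [IsTriangulated D] {X Y₁ R Y : C} {f : X ⟶ Y₁}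
    (H : Good F f) (s : Splitting Y₁ R Y) : Good F (f ≫ s.inl) := by
  obtain ⟨Z, α, β, H⟩ := H
  have t := Splitting.biprod Z R
  refine ⟨_, _, _, H.1.add_target_summand s t, ?_⟩
  have := H.2.add_target_summand (s.map F) (t.map F)
  simp only [F.map_comp, F.map_add, Category.assoc]
  exact this

end Common

/-! ### Extending a graded isomorphism between generators to an equivalence -/

section Graded

variable {C D : Type*} [Category* C] [Category* D] [Preadditive C] [Preadditive D]
  [HasShift C ℤ] [HasShift D ℤ]
  [∀ n : ℤ, (shiftFunctor C n).Additive] [∀ n : ℤ, (shiftFunctor D n).Additive]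
  {I : Type*}

lemma shiftedHom_comp_sum {X Y Z : C} {a b c : ℤ} {J : Type*} (s : Finset J)
    (f : ShiftedHom X Y a) (g : J → ShiftedHom Y Z b) (h : b + a = c) :
    f.comp (∑ j ∈ s, g j) h = ∑ j ∈ s, f.comp (g j) h :=
  map_sum (AddMonoidHom.mk' (fun g : ShiftedHom Y Z b => f.comp g h)
    (fun _ _ => ShiftedHom.comp_add _ _ _ _)) g s

lemma shiftedHom_sum_comp {X Y Z : C} {a b c : ℤ} {J : Type*} (s : Finset J)
    (f : J → ShiftedHom X Y a) (g : ShiftedHom Y Z b) (h : b + a = c) :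
    (∑ j ∈ s, f j).comp g h = ∑ j ∈ s, (f j).comp g h :=
  map_sum (AddMonoidHom.mk' (fun f : ShiftedHom X Y a => f.comp g h)
    (fun _ _ => ShiftedHom.add_comp _ _ _ _)) f s

lemma shiftedHom_comp_comp {X Y Z T : C} {a b c : ℤ} (f : ShiftedHom X Y a) (g : ShiftedHom Y Z b)
    (h : b + a = c) (k : Z ⟶ T) : f.comp g h ≫ k⟦c⟧' = f.comp (g ≫ k⟦b⟧') h := by
  simp only [ShiftedHom.comp, Functor.map_comp, Category.assoc]
  congr 2
  exact ((shiftFunctorAdd' C b a c h).inv.naturality k).symm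

variable (o : I → C) (o' : I → D)

/-- A degree-preserving additive and multiplicative bijection between the graded morphisms
of two families of objects. -/
structure GradedIso where
  equiv (i j : I) (n : ℤ) : ShiftedHom (o i) (o j) n ≃+ ShiftedHom (o' i) (o' j) n
  map_comp {i j k : I} {a b c : ℤ} (e : ShiftedHom (o i) (o j) a) (e' : ShiftedHom (o j) (o k) b)
    (h : b + a = c) : equiv i k c (e.comp e' h) = (equiv i j a e).comp (equiv j k b e') h

variable {o o'}

/-- The inverse of a graded isomorphism. -/
def GradedIso.symm (Θ : GradedIso o o') : GradedIso o' o where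
  equiv i j n := (Θ.equiv i j n).symm
  map_comp e e' h := by
    apply (Θ.equiv _ _ _).injective
    rw [Θ.map_comp]
    simp

variable (Θ : GradedIso o o')

/-- An identification of the graded modules represented by `X` and `Y`. -/
structure Partner (X : C) (Y : D) where
  equiv (i : I) (n : ℤ) : ShiftedHom (o i) X n ≃+ ShiftedHom (o' i) Y n
  map_comp {i j : I} {a b c : ℤ} (e : ShiftedHom (o i) (o j) a) (x : ShiftedHom (o j) X b)
    (h : b + a = c) : equiv i c (e.comp x h) = (Θ.equiv i j a e).comp (equiv j b x) h

/-- Morphisms inducing the same map on graded modules. -/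
def Compat {Θ : GradedIso o o'} {X X' : C} {Y Y' : D} (P : Partner Θ X Y) (P' : Partner Θ X' Y')
    (f : X ⟶ X') (g : Y ⟶ Y') : Prop :=
  ∀ (i : I) (n : ℤ) (x : ShiftedHom (o i) X n),
    P'.equiv i n (x ≫ f⟦n⟧') = P.equiv i n x ≫ g⟦n⟧'

variable (o) in
/-- The object `X` is a retract of a finite direct sum of shifts of objects of the family. -/
def GeneratedBy (X : C) : Prop :=
  ∃ (k : ℕ) (j : Fin k → I) (m : Fin k → ℤ) (p : ∀ s, ShiftedHom X (o (j s)) (m s))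
    (y : ∀ s, ShiftedHom (o (j s)) X (-(m s))),
    ∑ s, (p s).comp (y s) (neg_add_cancel (m s)) = ShiftedHom.mk₀ 0 rfl (𝟙 X)

variable {Θ}

namespace Partner

variable {X X' X'' : C} {Y Y' Y'' : D} (P : Partner Θ X Y) (P' : Partner Θ X' Y')
  (P'' : Partner Θ X'' Y'')

/-- The inverse identification. -/
def symm : Partner Θ.symm Y X where
  equiv i n := (P.equiv i n).symm
  map_comp {i j a b c} e x h := by
    apply (P.equiv _ _).injective
    rw [P.map_comp]
    simp [GradedIso.symm]

variable (Θ) in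
/-- The objects of the two families are identified. -/
def self (i : I) : Partner Θ (o i) (o' i) where
  equiv j n := Θ.equiv j i n
  map_comp e x h := Θ.map_comp e x h

/-- Transport along isomorphisms. -/
def ofIso (e : X ≅ X') (e' : Y ≅ Y') : Partner Θ X' Y' where
  equiv i n :=
    { toFun x := P.equiv i n (x ≫ e.inv⟦n⟧') ≫ e'.hom⟦n⟧'
      invFun y := (P.equiv i n).symm (y ≫ e'.inv⟦n⟧') ≫ e.hom⟦n⟧'
      left_inv x := by simp [← Functor.map_comp]
      right_inv y := by simp [← Functor.map_comp]
      map_add' x y := by simp }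
  map_comp e x h := by
    change P.equiv _ _ (_ ≫ _) ≫ _ = ShiftedHom.comp _ (P.equiv _ _ (_ ≫ _) ≫ _) _
    rw [shiftedHom_comp_comp, P.map_comp, shiftedHom_comp_comp]

lemma comp_shift_inv {Z X : C} {j : C} {a b c n m : ℤ} (e : ShiftedHom Z j b)
    (x : ShiftedHom j (X⟦a⟧) n) (h : n + b = c) (hm : a + n = m) {d : ℤ} (hd : a + c = d) :
    e.comp x h ≫ (shiftFunctorAdd' C a c d hd).inv.app X =
      e.comp (c := d) (x ≫ (shiftFunctorAdd' C a n m hm).inv.app X) (by lia) := by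
  simp only [ShiftedHom.comp, Functor.map_comp, Category.assoc]
  rw [shiftFunctorAdd'_assoc_inv_app a n b m c d hm h (by lia)]

lemma comp_shift_hom {Z X : C} {j : C} {a b c n m : ℤ} (e : ShiftedHom Z j b)
    (x : ShiftedHom j X m) (hm : a + n = m) {d : ℤ} (h : m + b = d) (hd : n + b = c) :
    e.comp x h ≫ (shiftFunctorAdd' C a c d (by lia)).hom.app X =
      e.comp (x ≫ (shiftFunctorAdd' C a n m hm).hom.app X) hd := by
  have := comp_shift_inv e (x ≫ (shiftFunctorAdd' C a n m hm).hom.app X) hd hm (d := d) (by lia)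
  rw [Category.assoc, Iso.hom_inv_id_app] at this
  rw [← cancel_mono ((shiftFunctorAdd' C a c d (by lia)).inv.app X), Category.assoc,
    Iso.hom_inv_id_app, this]
  simp

/-- The identification of the shifts of identified objects. -/
def shift (a : ℤ) : Partner Θ (X⟦a⟧) (Y⟦a⟧) where
  equiv i n :=
    { toFun x := P.equiv i (a + n) (x ≫ (shiftFunctorAdd' C a n _ rfl).inv.app X) ≫
        (shiftFunctorAdd' D a n _ rfl).hom.app Y
      invFun y := (P.equiv i (a + n)).symm (y ≫ (shiftFunctorAdd' D a n _ rfl).inv.app Y) ≫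
        (shiftFunctorAdd' C a n _ rfl).hom.app X
      left_inv x := by simp
      right_inv y := by simp
      map_add' x y := by simp }
  map_comp e x h := by
    change P.equiv _ _ (_ ≫ _) ≫ _ = ShiftedHom.comp _ (P.equiv _ _ (_ ≫ _) ≫ _) _
    rw [comp_shift_inv e x h rfl rfl, P.map_comp, comp_shift_hom _ _ rfl]

/-- Leaving `m` free avoids transports along equalities of integers. -/
lemma shift_equiv_apply {a n m : ℤ} (h : a + n = m) (i : I) (x : ShiftedHom (o i) (X⟦a⟧) n) :
    (P.shift a).equiv i n x = P.equiv i m (x ≫ (shiftFunctorAdd' C a n m h).inv.app X) ≫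
      (shiftFunctorAdd' D a n m h).hom.app Y := by
  subst h
  rfl

lemma sum_map_ι_comp_map_π [HasFiniteBiproducts C] {k : ℕ} (X : Fin k → C) {W : C} (n : ℤ)
    (a : ∀ s, W ⟶ (X s)⟦n⟧) (s : Fin k) :
    ∑ t, a t ≫ (biproduct.ι X t)⟦n⟧' ≫ (biproduct.π X s)⟦n⟧' = a s := by
  rw [Finset.sum_eq_single s]
  · simp [← Functor.map_comp]
  · intro t _ ht
    rw [← Functor.map_comp, biproduct.ι_π_ne _ ht, Functor.map_zero, comp_zero]
  · simp

lemma sum_comp_map_π_comp_map_ι [HasFiniteBiproducts C] {k : ℕ} (X : Fin k → C) {W : C} (n : ℤ)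
    (a : W ⟶ (⨁ X)⟦n⟧) :
    ∑ s, a ≫ (biproduct.π X s)⟦n⟧' ≫ (biproduct.ι X s)⟦n⟧' = a := by
  have := congrArg (fun f => a ≫ f⟦n⟧') (biproduct.total (f := X))
  simp only [Functor.map_sum, Preadditive.comp_sum, Functor.map_comp, CategoryTheory.Functor.map_id,
    Category.comp_id] at this
  exact this

/-- The identification of the direct sums of identified objects. -/
noncomputable def biproduct [HasFiniteBiproducts C] [HasFiniteBiproducts D] {k : ℕ} {X : Fin k → C}
    {Y : Fin k → D} (P : ∀ s, Partner Θ (X s) (Y s)) : Partner Θ (⨁ X) (⨁ Y) where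
  equiv i n :=
    { toFun x := ∑ s, (P s).equiv i n (x ≫ (biproduct.π X s)⟦n⟧') ≫ (biproduct.ι Y s)⟦n⟧'
      invFun y := ∑ s, ((P s).equiv i n).symm (y ≫ (biproduct.π Y s)⟦n⟧') ≫ (biproduct.ι X s)⟦n⟧'
      left_inv x := by
        simp only [Preadditive.sum_comp, Category.assoc, sum_map_ι_comp_map_π,
          AddEquiv.symm_apply_apply, sum_comp_map_π_comp_map_ι]
      right_inv y := by
        simp only [Preadditive.sum_comp, Category.assoc, sum_map_ι_comp_map_π,
          AddEquiv.apply_symm_apply, sum_comp_map_π_comp_map_ι]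
      map_add' x y := by simp [Finset.sum_add_distrib] }
  map_comp e x h := by
    change ∑ s, (P s).equiv _ _ (_ ≫ _) ≫ _ = ShiftedHom.comp _ (∑ s, (P s).equiv _ _ (_ ≫ _) ≫ _) _
    rw [shiftedHom_comp_sum]
    refine Finset.sum_congr rfl (fun s _ => ?_)
    rw [shiftedHom_comp_comp, (P s).map_comp, shiftedHom_comp_comp]

end Partner

namespace Compat

variable {X X' X'' : C} {Y Y' Y'' : D} {P : Partner Θ X Y} {P' : Partner Θ X' Y'}
  {P'' : Partner Θ X'' Y''}

lemma id (P : Partner Θ X Y) : Compat P P (𝟙 X) (𝟙 Y) := fun i n x => by simp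

lemma comp {f : X ⟶ X'} {g : Y ⟶ Y'} {f' : X' ⟶ X''} {g' : Y' ⟶ Y''} (H : Compat P P' f g)
    (H' : Compat P' P'' f' g') : Compat P P'' (f ≫ f') (g ≫ g') := fun i n x => by
  have := H' i n (x ≫ f⟦n⟧')
  rw [H i n x] at this
  simpa using this

lemma symm {f : X ⟶ X'} {g : Y ⟶ Y'} (H : Compat P P' f g) : Compat P.symm P'.symm g f :=
  fun i n y => by
    apply (P'.equiv i n).injective
    have := H i n ((P.equiv i n).symm y)
    change P'.equiv i n ((P'.equiv i n).symm _) = P'.equiv i n ((P.equiv i n).symm y ≫ _)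
    rw [this]
    simp

lemma add {f f₁ : X ⟶ X'} {g g₁ : Y ⟶ Y'} (H : Compat P P' f g) (H₁ : Compat P P' f₁ g₁) :
    Compat P P' (f + f₁) (g + g₁) := fun i n x => by
  simp [Functor.map_add, H i n x, H₁ i n x]

lemma shift {f : X ⟶ X'} {g : Y ⟶ Y'} (H : Compat P P' f g) (a : ℤ) :
    Compat (P.shift a) (P'.shift a) (f⟦a⟧') (g⟦a⟧') := fun i n x => by
  rw [P'.shift_equiv_apply rfl, P.shift_equiv_apply rfl, Category.assoc, Category.assoc]
  have h₁ := (shiftFunctorAdd' C a n _ rfl).inv.naturality f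
  have h₂ := (shiftFunctorAdd' D a n _ rfl).hom.naturality g
  have h₃ := H i (a + n) (x ≫ (shiftFunctorAdd' C a n _ rfl).inv.app X)
  dsimp at h₁ h₂
  rw [h₁, ← h₂, ← Category.assoc, h₃, Category.assoc]

lemma shiftZero (P : Partner Θ X Y) : Compat (P.shift 0) P ((shiftFunctorZero C ℤ).hom.app X)
    ((shiftFunctorZero D ℤ).hom.app Y) := fun i n x => by
  rw [P.shift_equiv_apply (zero_add n), Category.assoc, shiftFunctorAdd'_zero_add_inv_app,
    shiftFunctorAdd'_zero_add_hom_app, ← Functor.map_comp, Iso.inv_hom_id_app]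
  simp

lemma shiftAdd (P : Partner Θ X Y) (a b : ℤ) :
    Compat (P.shift (a + b)) ((P.shift a).shift b) ((shiftFunctorAdd C a b).hom.app X)
      ((shiftFunctorAdd D a b).hom.app Y) := fun i n x => by
  rw [P.shift_equiv_apply (m := a + (b + n)) (by lia), (P.shift a).shift_equiv_apply rfl,
    P.shift_equiv_apply rfl, Category.assoc, Category.assoc, Category.assoc,
    ← shiftFunctorAdd'_eq_shiftFunctorAdd, ← shiftFunctorAdd'_eq_shiftFunctorAdd]
  have h₁ := shiftFunctorAdd'_assoc_hom_app a b n (a + b) (b + n) (a + (b + n)) rfl rfl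
    (by lia) Y
  have h₂ := shiftFunctorAdd'_assoc_inv_app a b n (a + b) (b + n) (a + (b + n)) rfl rfl
    (by lia) X
  rw [← h₂, ← Functor.map_comp_assoc, Iso.hom_inv_id_app]
  simp only [Category.assoc, CategoryTheory.Functor.map_id, Category.id_comp]
  rw [h₁]

/-- A Yoneda argument: if the identity of `Y` is `∑ pₛ yₛ` with `yₛ` defined on generators, then a
compatible `g` must send `yₛ` to the element `zₛ` dictated by `f`, so `g = ∑ pₛ zₛ`. Conversely this
`g` is compatible, since every `b` equals `∑ (b pₛ) yₛ` and all identifications are linear over `Θ`.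
-/
lemma existsUnique (hY : GeneratedBy o' Y) (P : Partner Θ X Y) (P' : Partner Θ X' Y')
    (f : X ⟶ X') : ∃! g : Y ⟶ Y', Compat P P' f g := by
  obtain ⟨k, j, m, p, y, hpy⟩ := hY
  have key {T : D} {n : ℤ} (b : ShiftedHom T Y n) :
      b = ∑ s, (b.comp (p s) (c := m s + n) rfl).comp (y s) (by lia) := by
    have := ShiftedHom.comp_mk₀_id b 0 rfl
    rw [← hpy, shiftedHom_comp_sum] at this
    conv_lhs => rw [← this]
    refine Finset.sum_congr rfl (fun s _ => ?_)
    rw [ShiftedHom.comp_assoc]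
    lia
  let z (s : Fin k) : ShiftedHom (o' (j s)) Y' (-(m s)) :=
    P'.equiv _ _ ((P.equiv _ _).symm (y s) ≫ f⟦-(m s)⟧')
  obtain ⟨g, hg⟩ := (ShiftedHom.homEquiv (X := Y) (Y := Y') (0 : ℤ) rfl).surjective
    (∑ s, (p s).comp (z s) (neg_add_cancel (m s)))
  rw [ShiftedHom.homEquiv_apply] at hg
  refine ⟨g, fun i n x => ?_, fun g' hg' => ?_⟩
  · obtain ⟨b, rfl⟩ := (P.equiv i n).symm.surjective x
    have hx : (P.equiv i n).symm b = ∑ s, ((Θ.equiv _ _ _).symm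
        (b.comp (p s) (c := m s + n) rfl)).comp ((P.equiv _ _).symm (y s)) (by lia) := by
      apply (P.equiv i n).injective
      rw [map_sum, AddEquiv.apply_symm_apply]
      conv_lhs => rw [key b]
      refine Finset.sum_congr rfl (fun s _ => ?_)
      rw [P.map_comp]
      simp
    rw [AddEquiv.apply_symm_apply, hx, Preadditive.sum_comp, map_sum,
      ← ShiftedHom.comp_mk₀ b 0 rfl g, hg, shiftedHom_comp_sum]
    refine Finset.sum_congr rfl (fun s _ => ?_)
    rw [shiftedHom_comp_comp, P'.map_comp, AddEquiv.apply_symm_apply, ShiftedHom.comp_assoc]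
    lia
  · have hz (s : Fin k) : y s ≫ g'⟦-(m s)⟧' = z s := by
      have := hg' _ _ ((P.equiv _ _).symm (y s))
      rw [AddEquiv.apply_symm_apply] at this
      exact this.symm
    apply (ShiftedHom.homEquiv (X := Y) (Y := Y') (0 : ℤ) rfl).injective
    rw [ShiftedHom.homEquiv_apply, ShiftedHom.homEquiv_apply, hg]
    have := ShiftedHom.mk₀_comp_mk₀ (𝟙 Y) g' (a := (0 : ℤ)) (b := 0) (c := 0) (by simp) rfl rfl
    rw [Category.id_comp, ← hpy, shiftedHom_sum_comp] at this
    rw [← this]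
    refine Finset.sum_congr rfl (fun s _ => ?_)
    rw [ShiftedHom.comp_mk₀ _ 0 rfl, shiftedHom_comp_comp, hz]

lemma inv {e : X ≅ X'} {e' : Y ≅ Y'} (H : Compat P P' e.hom e'.hom) :
    Compat P' P e.inv e'.inv := fun i n x => by
  rw [← cancel_mono (e'.hom⟦n⟧'), ← H]
  simp [← Functor.map_comp]

lemma unique (hY : GeneratedBy o' Y) {f : X ⟶ X'} {g g' : Y ⟶ Y'} (h : Compat P P' f g)
    (h' : Compat P P' f g') : g = g' :=
  (existsUnique hY P P' f).unique h h'

lemma exists_iso (hY : GeneratedBy o' Y) (hY' : GeneratedBy o' Y') (P : Partner Θ X Y)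
    (P' : Partner Θ X' Y') (e : X ≅ X') : ∃ e' : Y ≅ Y', Compat P P' e.hom e'.hom := by
  obtain ⟨g, hg, -⟩ := existsUnique hY P P' e.hom
  obtain ⟨g', hg', -⟩ := existsUnique hY' P' P e.inv
  refine ⟨⟨g, g', unique hY (hg.comp hg') ?_, unique hY' (hg'.comp hg) ?_⟩, hg⟩
  · rw [e.hom_inv_id]
    exact Compat.id P
  · rw [e.inv_hom_id]
    exact Compat.id P'

/-- This is multiplicativity of `Θ`, read as a statement about right multiplication by `e`. It
identifies the action of the functor built below on graded morphisms with `Θ`. -/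
lemma self_shift {i j : I} {n : ℤ} (e : ShiftedHom (o i) (o j) n) :
    Compat (Partner.self Θ i) ((Partner.self Θ j).shift n) e (Θ.equiv i j n e) := fun k m x => by
  rw [Partner.shift_equiv_apply _ rfl]
  have := Θ.map_comp x e rfl
  simp only [ShiftedHom.comp] at this
  simp only [Partner.self, Category.assoc]
  rw [this]
  simp

end Compat

/-- Once a partner is chosen for each object, everything is forced: the morphisms, the commutation
with shifts and all coherences follow from uniqueness of compatible morphisms. Full faithfulness is
the same uniqueness and existence for the inverse identification. -/
lemma exists_functor (hC : ∀ X : C, ∃ Y : D, Nonempty (Partner Θ X Y))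
    (hC' : ∀ X : C, GeneratedBy o X) (hD : ∀ Y : D, ∃ X : C, Nonempty (Partner Θ X Y))
    (hD' : ∀ Y : D, GeneratedBy o' Y) :
    ∃ (F : C ⥤ D) (_ : F.CommShift ℤ) (_ : F.Additive) (u : ∀ i, F.obj (o i) ≅ o' i),
      F.IsEquivalence ∧ ∀ (i j : I) (n : ℤ) (e : ShiftedHom (o i) (o j) n),
        F.map e ≫ (F.commShiftIso n).hom.app (o j) ≫ (u j).hom⟦n⟧' =
          (u i).hom ≫ Θ.equiv i j n e := by
  choose obj Q' using hC
  have Q (X : C) : Partner Θ X (obj X) := (Q' X).some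
  choose map hmap _ using fun (X X' : C) (f : X ⟶ X') =>
    Compat.existsUnique (hD' _) (Q X) (Q X') f
  let F : C ⥤ D :=
    { obj := obj
      map {X X'} f := map X X' f
      map_id X := (hmap _ _ _).unique (hD' _) (Compat.id _)
      map_comp f g := (hmap _ _ _).unique (hD' _) ((hmap _ _ f).comp (hmap _ _ g)) }
  have hF {X X' : C} (f : X ⟶ X') : Compat (Q X) (Q X') f (F.map f) := hmap _ _ f
  have hadd : F.Additive := ⟨(hF _).unique (hD' _) ((hF _).add (hF _))⟩
  choose s hs using fun (a : ℤ) (X : C) =>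
    Compat.exists_iso (hD' _) (hD' _) (Q (X⟦a⟧)) ((Q X).shift a) (Iso.refl _)
  have hs' (a : ℤ) (X : C) : Compat (Q (X⟦a⟧)) ((Q X).shift a) (𝟙 _) (s a X).hom := hs a X
  let S : F.CommShift ℤ :=
    { commShiftIso a := NatIso.ofComponents (s a) (fun {X X'} f => by
        refine Compat.unique (hD' _) (f := f⟦a⟧') (P := Q (X⟦a⟧)) (P' := (Q X').shift a) ?_ ?_
        · simpa using (hF (f⟦a⟧')).comp (hs' a X')
        · simpa using (hs' a X).comp ((hF f).shift a))
      commShiftIso_zero := by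
        ext X
        rw [Functor.CommShift.isoZero_hom_app]
        refine (hs' 0 X).unique (hD' _) ?_
        have := (hF ((shiftFunctorZero C ℤ).hom.app X)).comp (Compat.inv (e := (shiftFunctorZero C ℤ).app X)
          (e' := (shiftFunctorZero D ℤ).app (obj X)) (Compat.shiftZero (Q X)))
        simpa using this
      commShiftIso_add a b := by
        ext X
        rw [Functor.CommShift.isoAdd_hom_app]
        refine (hs' (a + b) X).unique (hD' _) ?_
        have := (((hF ((shiftFunctorAdd C a b).hom.app X)).comp (hs' b (X⟦a⟧))).comp
          ((hs' a X).shift b)).comp (Compat.inv (e := (shiftFunctorAdd C a b).app X)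
            (e' := (shiftFunctorAdd D a b).app (obj X)) (Compat.shiftAdd (Q X) a b))
        simpa using this }
  choose u hu using fun i =>
    Compat.exists_iso (hD' _) (hD' _) (Q (o i)) (Partner.self Θ i) (Iso.refl _)
  have hu' (i : I) : Compat (Q (o i)) (Partner.self Θ i) (𝟙 _) (u i).hom := hu i
  refine ⟨F, S, hadd, u, ?_, fun i j n e => ?_⟩
  · have : F.Faithful := ⟨fun {X Y f g} h => by
      have h₁ := (hF f).symm
      rw [h] at h₁
      exact h₁.unique (hC' _) (hF g).symm⟩
    have : F.Full := ⟨fun {X Y} g => by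
      obtain ⟨f, hf, -⟩ := Compat.existsUnique (hC' _) (Q X).symm (Q Y).symm g
      exact ⟨f, (hF f).unique (hD' _) hf.symm⟩⟩
    have : F.EssSurj := ⟨fun Y => by
      obtain ⟨X, ⟨P⟩⟩ := hD Y
      obtain ⟨e, -⟩ := Compat.exists_iso (hD' _) (hD' _) (Q X) P (Iso.refl _)
      exact ⟨X, ⟨e⟩⟩⟩
    exact { }
  · have h₁ := ((hF e).comp (hs' n (o j))).comp ((hu' j).shift n)
    have h₂ := (hu' i).comp (Compat.self_shift e)
    refine Compat.unique (hD' _) (f := e) (P := Q (o i)) (P' := (Partner.self Θ j).shift n) ?_ ?_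
    · rw [CategoryTheory.Functor.map_id, Category.comp_id, Category.comp_id, Category.assoc] at h₁
      exact h₁
    · rw [Category.id_comp] at h₂
      exact h₂

end Graded

/-! ### Categories whose objects are sums of shifts of a family -/

section Generation

variable {C D : Type*} [Category* C] [Category* D] [Preadditive C] [Preadditive D]
  [HasZeroObject C] [HasZeroObject D] [HasShift C ℤ] [HasShift D ℤ]
  [∀ n : ℤ, (shiftFunctor C n).Additive] [∀ n : ℤ, (shiftFunctor D n).Additive]
  [Pretriangulated C] [Pretriangulated D] {I : Type*}

/-- Every object is a finite direct sum of shifts of objects of the family. -/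
def Decomposes (o : I → C) : Prop :=
  ∀ X : C, additiveClosure (fun Y => ∃ (i : I) (m : ℤ), Nonempty (Y ≅ (o i)⟦m⟧)) X

variable {o : I → C} {o' : I → D}

lemma Decomposes.exists_partner (h : Decomposes o) (Θ : GradedIso o o') (X : C) :
    ∃ Y : D, Nonempty (Partner Θ X Y) := by
  obtain ⟨k, Y, hY, ⟨e⟩⟩ := h X
  choose i m h using hY
  exact ⟨⨁ (fun s => (o' (i s))⟦m s⟧), ⟨(Partner.biproduct fun s =>
    ((Partner.self Θ (i s)).shift (m s)).ofIso (h s).some.symm (Iso.refl _)).ofIso e.symm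
      (Iso.refl _)⟩⟩

lemma Decomposes.generatedBy (h : Decomposes o) (X : C) : GeneratedBy o X := by
  obtain ⟨k, Y, hY, ⟨e⟩⟩ := h X
  choose i m h using hY
  have (s : Fin k) : ∃ y : ShiftedHom (o (i s)) X (-(m s)), y⟦m s⟧' =
      ((h s).some.inv ≫ biproduct.ι Y s ≫ e.inv) ≫ (shiftFunctorZero C ℤ).inv.app X ≫
        (shiftFunctorAdd' C (-(m s)) (m s) 0 (neg_add_cancel _)).hom.app X :=
    (shiftFunctor C (m s)).map_surjective _
  choose y hy using this
  refine ⟨k, i, m, fun s => e.hom ≫ biproduct.π Y s ≫ (h s).some.hom, y, ?_⟩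
  have key : ∑ s, e.hom ≫ biproduct.π Y s ≫ biproduct.ι Y s ≫ e.inv = 𝟙 X := by
    have := congrArg (fun f => e.hom ≫ f ≫ e.inv) (biproduct.total (f := Y))
    simpa [Preadditive.sum_comp, Preadditive.comp_sum, -biproduct.total] using this
  have h₀ : ShiftedHom.mk₀ (0 : ℤ) rfl (𝟙 X) = 𝟙 X ≫ (shiftFunctorZero C ℤ).inv.app X := by
    simp [ShiftedHom.mk₀, shiftFunctorZero']
  rw [h₀, ← key, Preadditive.sum_comp]
  refine Finset.sum_congr rfl (fun s _ => ?_)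
  simp [ShiftedHom.comp, hy]

/-- Triangulated categories generated by families of objects with isomorphic graded morphisms
are equivalent, as categories with a shift. -/
lemma Decomposes.exists_functor (h : Decomposes o) (h' : Decomposes o') (Θ : GradedIso o o') :
    ∃ (F : C ⥤ D) (_ : F.CommShift ℤ) (_ : F.Additive) (u : ∀ i, F.obj (o i) ≅ o' i),
      F.IsEquivalence ∧ ∀ (i j : I) (n : ℤ) (e : ShiftedHom (o i) (o j) n),
        F.map e ≫ (F.commShiftIso n).hom.app (o j) ≫ (u j).hom⟦n⟧' =
          (u i).hom ≫ Θ.equiv i j n e := by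
  refine PathTriang.exists_functor (h.exists_partner Θ) h.generatedBy (fun Y => ?_) h'.generatedBy
  obtain ⟨X, ⟨P⟩⟩ := h'.exists_partner Θ.symm Y
  exact ⟨X, ⟨P.symm⟩⟩

end Generation

/-! ### Comparison of two triangulated categories with the same heart -/

section Hearts

variable {H C D : Type*} [Category* H] [Abelian H] [Category* C] [Category* D] [Preadditive C]
  [Preadditive D] [HasZeroObject C] [HasZeroObject D] [HasShift C ℤ] [HasShift D ℤ]
  [∀ n : ℤ, (shiftFunctor C n).Additive] [∀ n : ℤ, (shiftFunctor D n).Additive]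
  [Pretriangulated C] [Pretriangulated D]

/-- The abelian category `H` is embedded in `C` in such a way that there are no morphisms of
negative degree, and that morphisms of degree one are the classes of the extensions in `H`. -/
structure IsHeart (ι : H ⥤ C) [ι.Full] [ι.Faithful] [ι.Additive] : Prop where
  zero_of_neg {A B : H} {n : ℤ} (hn : n < 0) (f : ι.obj A ⟶ (ι.obj B)⟦n⟧) : f = 0
  exists_dist {A B E : H} (f : B ⟶ E) (g : E ⟶ A) (w : f ≫ g = 0)
    (hS : (ShortComplex.mk f g w).ShortExact) :
    ∃ e : ι.obj A ⟶ (ι.obj B)⟦(1 : ℤ)⟧, Dist (ι.map f) (ι.map g) e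
  exists_shortExact {A B : H} (e : ι.obj A ⟶ (ι.obj B)⟦(1 : ℤ)⟧) :
    ∃ (E : H) (f : B ⟶ E) (g : E ⟶ A) (w : f ≫ g = 0), (ShortComplex.mk f g w).ShortExact ∧
      Dist (ι.map f) (ι.map g) e

/-- There are no morphisms of degree at least two between objects of `H`. -/
def Hereditary (ι : H ⥤ C) : Prop :=
  ∀ (A B : H) (n : ℤ), 2 ≤ n → ∀ f : ι.obj A ⟶ (ι.obj B)⟦n⟧, f = 0

variable (ι : H ⥤ C) (ι' : H ⥤ D) [ι.Full] [ι.Faithful] [ι.Additive] [ι'.Full] [ι'.Faithful]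
  [ι'.Additive]

/-- The morphisms `e` and `e'` of degree one are the classes of the same extension. -/
def SameExt {A B : H} (e : ι.obj A ⟶ (ι.obj B)⟦(1 : ℤ)⟧) (e' : ι'.obj A ⟶ (ι'.obj B)⟦(1 : ℤ)⟧) :
    Prop :=
  ∃ (E : H) (f : B ⟶ E) (g : E ⟶ A) (w : f ≫ g = 0), (ShortComplex.mk f g w).ShortExact ∧
    Dist (ι.map f) (ι.map g) e ∧ Dist (ι'.map f) (ι'.map g) e'

variable {ι ι'}

namespace SameExt

lemma symm {A B : H} {e : ι.obj A ⟶ (ι.obj B)⟦(1 : ℤ)⟧} {e' : ι'.obj A ⟶ (ι'.obj B)⟦(1 : ℤ)⟧}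
    (h : SameExt ι ι' e e') : SameExt ι' ι e' e := by
  obtain ⟨E, f, g, w, hS, h₁, h₂⟩ := h
  exact ⟨E, f, g, w, hS, h₂, h₁⟩

lemma exists_right (h : IsHeart ι) (h' : IsHeart ι') {A B : H} (e : ι.obj A ⟶ (ι.obj B)⟦(1 : ℤ)⟧) :
    ∃ e', SameExt ι ι' e e' := by
  obtain ⟨E, f, g, w, hS, h₁⟩ := h.exists_shortExact e
  obtain ⟨e', h₂⟩ := h'.exists_dist f g w hS
  exact ⟨e', E, f, g, w, hS, h₁, h₂⟩

/-- The hypothesis yields a morphism between the two extensions; by full faithfulness it lives in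
`H`, which no longer refers to `C`, and it can be read off in `D`. -/
lemma naturality {A B A' B' : H} {e : ι.obj A ⟶ (ι.obj B)⟦(1 : ℤ)⟧}
    {e' : ι'.obj A ⟶ (ι'.obj B)⟦(1 : ℤ)⟧} (h : SameExt ι ι' e e')
    {x : ι.obj A' ⟶ (ι.obj B')⟦(1 : ℤ)⟧}
    {x' : ι'.obj A' ⟶ (ι'.obj B')⟦(1 : ℤ)⟧} (hx : SameExt ι ι' x x') (a : A ⟶ A') (b : B ⟶ B')
    (comm : e ≫ (ι.map b)⟦(1 : ℤ)⟧' = ι.map a ≫ x) :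
    e' ≫ (ι'.map b)⟦(1 : ℤ)⟧' = ι'.map a ≫ x' := by
  obtain ⟨E, f, g, w, hS, h₁, h₂⟩ := h
  obtain ⟨E', f', g', w', hS', h₁', h₂'⟩ := hx
  obtain ⟨φ, hφ₁, hφ₂⟩ := h₁.exists_hom₂ h₁' (ι.map b) (ι.map a) comm
  obtain ⟨ψ, rfl⟩ := ι.map_surjective φ
  rw [← ι.map_comp, ← ι.map_comp] at hφ₁ hφ₂
  replace hφ₁ := ι.map_injective hφ₁
  replace hφ₂ := ι.map_injective hφ₂
  obtain ⟨c, hc₁, hc₂⟩ := h₂.exists_hom₃ h₂' (ι'.map b) (ι'.map ψ) (by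
    rw [← ι'.map_comp, hφ₁, ι'.map_comp])
  obtain ⟨d, rfl⟩ := ι'.map_surjective c
  rw [← ι'.map_comp, ← ι'.map_comp, ← hφ₂] at hc₁
  have : Epi g := hS.epi_g
  rw [hc₂, (cancel_epi g).1 (ι'.map_injective hc₁)]

lemma unique {A B : H} {e : ι.obj A ⟶ (ι.obj B)⟦(1 : ℤ)⟧}
    {e' e'' : ι'.obj A ⟶ (ι'.obj B)⟦(1 : ℤ)⟧} (h : SameExt ι ι' e e') (h' : SameExt ι ι' e e'') :
    e' = e'' := by
  simpa using h.naturality h' (𝟙 A) (𝟙 B) (by simp)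

lemma comp_left (h : IsHeart ι) (h' : IsHeart ι') {A B A' : H} {x : ι.obj A' ⟶ (ι.obj B)⟦(1 : ℤ)⟧}
    {x' : ι'.obj A' ⟶ (ι'.obj B)⟦(1 : ℤ)⟧} (hx : SameExt ι ι' x x') (a : A ⟶ A') :
    SameExt ι ι' (ι.map a ≫ x) (ι'.map a ≫ x') := by
  obtain ⟨y, hy⟩ := exists_right h h' (ι.map a ≫ x)
  have := hy.naturality hx a (𝟙 B) (by simp)
  simp only [CategoryTheory.Functor.map_id, Category.comp_id] at this
  rwa [← this]

lemma comp_right (h : IsHeart ι) (h' : IsHeart ι') {A B B' : H} {e : ι.obj A ⟶ (ι.obj B)⟦(1 : ℤ)⟧}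
    {e' : ι'.obj A ⟶ (ι'.obj B)⟦(1 : ℤ)⟧} (he : SameExt ι ι' e e') (b : B ⟶ B') :
    SameExt ι ι' (e ≫ (ι.map b)⟦(1 : ℤ)⟧') (e' ≫ (ι'.map b)⟦(1 : ℤ)⟧') := by
  obtain ⟨y, hy⟩ := exists_right h h' (e ≫ (ι.map b)⟦(1 : ℤ)⟧')
  have := he.naturality hy (𝟙 A) b (by simp)
  simp only [CategoryTheory.Functor.map_id, Category.id_comp] at this
  rwa [this]

/-- The Baer sum: the class with components `e₁` and `e₂` in `B ⊞ B` is transferred first, and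
naturality computes its components and its image under the sum `B ⊞ B ⟶ B`. -/
lemma add (h : IsHeart ι) (h' : IsHeart ι') {A B : H} {e₁ e₂ : ι.obj A ⟶ (ι.obj B)⟦(1 : ℤ)⟧}
    {e₁' e₂' : ι'.obj A ⟶ (ι'.obj B)⟦(1 : ℤ)⟧} (h₁ : SameExt ι ι' e₁ e₁')
    (h₂ : SameExt ι ι' e₂ e₂') : SameExt ι ι' (e₁ + e₂) (e₁' + e₂') := by
  obtain ⟨y, hy⟩ := exists_right h h' (e₁ ≫ (ι.map (biprod.inl : B ⟶ B ⊞ B))⟦(1 : ℤ)⟧' +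
    e₂ ≫ (ι.map (biprod.inr : B ⟶ B ⊞ B))⟦(1 : ℤ)⟧')
  have k₁ := hy.naturality h₁ (𝟙 A) biprod.fst (by simp [← Functor.map_comp])
  have k₂ := hy.naturality h₂ (𝟙 A) biprod.snd (by simp [← Functor.map_comp])
  have k₃ := hy.comp_right h h' (biprod.fst + biprod.snd)
  simp only [CategoryTheory.Functor.map_id, Category.id_comp] at k₁ k₂
  rw [Functor.map_add, Functor.map_add, Functor.map_add, Functor.map_add, Preadditive.comp_add,
    Preadditive.comp_add, k₁, k₂] at k₃
  convert k₃ using 1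
  simp [← Functor.map_comp]

end SameExt

lemma GradedIso.exists_of_rel {I : Type*} {o : I → C} {o' : I → D}
    (ρ : ∀ {i j : I} {n : ℤ}, ShiftedHom (o i) (o j) n → ShiftedHom (o' i) (o' j) n → Prop)
    (ex : ∀ {i j : I} {n : ℤ} (e : ShiftedHom (o i) (o j) n), ∃ e', ρ e e')
    (ex' : ∀ {i j : I} {n : ℤ} (e' : ShiftedHom (o' i) (o' j) n), ∃ e, ρ e e')
    (un : ∀ {i j : I} {n : ℤ} {e : ShiftedHom (o i) (o j) n} {e₁ e₂}, ρ e e₁ → ρ e e₂ → e₁ = e₂)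
    (un' : ∀ {i j : I} {n : ℤ} {e : ShiftedHom (o' i) (o' j) n} {e₁ e₂},
      ρ e₁ e → ρ e₂ e → e₁ = e₂)
    (add : ∀ {i j : I} {n : ℤ} {e₁ e₂ : ShiftedHom (o i) (o j) n} {e₁' e₂'}, ρ e₁ e₁' →
      ρ e₂ e₂' → ρ (e₁ + e₂) (e₁' + e₂'))
    (comp : ∀ {i j k : I} {a b c : ℤ} {e₁ : ShiftedHom (o i) (o j) a}
      {e₂ : ShiftedHom (o j) (o k) b} {e₁' e₂'} (h : b + a = c), ρ e₁ e₁' →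
      ρ e₂ e₂' → ρ (e₁.comp e₂ h) (e₁'.comp e₂' h)) :
    ∃ Θ : GradedIso o o', ∀ {i j : I} {n : ℤ} (e : ShiftedHom (o i) (o j) n),
      ρ e (Θ.equiv i j n e) := by
  choose t ht using @ex
  choose s hs using @ex'
  exact ⟨⟨fun i j n => ⟨⟨t, s, fun x => un' (hs _) (ht _), fun y => un (ht _) (hs _)⟩,
    fun x y => un (ht _) (add (ht _) (ht _))⟩, fun e e' h => un (ht _) (comp h (ht _) (ht _))⟩,
    fun e => ht e⟩

variable (ι ι') in
/-- The identification of the graded morphisms between objects of the heart. -/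
def GradedRel {A B : H} {n : ℤ} (e : ShiftedHom (ι.obj A) (ι.obj B) n)
    (e' : ShiftedHom (ι'.obj A) (ι'.obj B) n) : Prop :=
  (∀ h : n = 0, ∃ f : A ⟶ B, e = ShiftedHom.mk₀ n h (ι.map f) ∧
    e' = ShiftedHom.mk₀ n h (ι'.map f)) ∧ ∀ h : n = 1, SameExt ι ι' (h ▸ e) (h ▸ e')

namespace GradedRel

lemma zero_iff {A B : H} {e : ShiftedHom (ι.obj A) (ι.obj B) (0 : ℤ)}
    {e' : ShiftedHom (ι'.obj A) (ι'.obj B) (0 : ℤ)} : GradedRel ι ι' e e' ↔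
      ∃ f : A ⟶ B, e = ShiftedHom.mk₀ 0 rfl (ι.map f) ∧ e' = ShiftedHom.mk₀ 0 rfl (ι'.map f) :=
  ⟨fun h => h.1 rfl, fun h => ⟨fun _ => h, fun h => by simp at h⟩⟩

lemma one_iff {A B : H} {e : ShiftedHom (ι.obj A) (ι.obj B) (1 : ℤ)}
    {e' : ShiftedHom (ι'.obj A) (ι'.obj B) (1 : ℤ)} : GradedRel ι ι' e e' ↔ SameExt ι ι' e e' :=
  ⟨fun h => h.2 rfl, fun h => ⟨fun h => by simp at h, fun _ => h⟩⟩

/-- The relation is vacuous outside degrees 0 and 1; this is harmless when the groups in question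
vanish, as in `eq_zero_of_ne`. -/
lemma of_ne {A B : H} {n : ℤ} (h₀ : n ≠ 0) (h₁ : n ≠ 1) (e : ShiftedHom (ι.obj A) (ι.obj B) n)
    (e' : ShiftedHom (ι'.obj A) (ι'.obj B) n) : GradedRel ι ι' e e' :=
  ⟨fun h => (h₀ h).elim, fun h => (h₁ h).elim⟩

lemma symm {A B : H} {n : ℤ} {e : ShiftedHom (ι.obj A) (ι.obj B) n}
    {e' : ShiftedHom (ι'.obj A) (ι'.obj B) n} (h : GradedRel ι ι' e e') : GradedRel ι' ι e' e :=
  ⟨fun hn => (h.1 hn).imp fun _ hf => hf.symm, fun hn => (h.2 hn).symm⟩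

lemma eq_zero_of_ne (h : IsHeart ι) (hι : Hereditary ι) {A B : H} {n : ℤ} (h₀ : n ≠ 0)
    (h₁ : n ≠ 1) (e : ShiftedHom (ι.obj A) (ι.obj B) n) : e = 0 := by
  obtain hn | hn : n < 0 ∨ 2 ≤ n := by lia
  · exact h.zero_of_neg hn e
  · exact hι _ _ _ hn e

lemma exists_right (h : IsHeart ι) (h' : IsHeart ι') {A B : H} {n : ℤ}
    (e : ShiftedHom (ι.obj A) (ι.obj B) n) : ∃ e', GradedRel ι ι' e e' := by
  by_cases h₀ : n = 0
  · subst h₀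
    obtain ⟨f, hf⟩ := (ShiftedHom.homEquiv (0 : ℤ) rfl).surjective e
    obtain ⟨g, rfl⟩ := ι.map_surjective f
    exact ⟨_, zero_iff.2 ⟨g, hf.symm, rfl⟩⟩
  by_cases h₁ : n = 1
  · subst h₁
    simp only [one_iff]
    exact SameExt.exists_right h h' e
  · exact ⟨0, of_ne h₀ h₁ _ _⟩

lemma unique (h' : IsHeart ι') (hι' : Hereditary ι') {A B : H} {n : ℤ}
    {e : ShiftedHom (ι.obj A) (ι.obj B) n} {e₁ e₂ : ShiftedHom (ι'.obj A) (ι'.obj B) n}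
    (k₁ : GradedRel ι ι' e e₁) (k₂ : GradedRel ι ι' e e₂) : e₁ = e₂ := by
  by_cases h₀ : n = 0
  · subst h₀
    obtain ⟨f, rfl, rfl⟩ := zero_iff.1 k₁
    obtain ⟨g, hg, rfl⟩ := zero_iff.1 k₂
    rw [ι.map_injective ((ShiftedHom.homEquiv (0 : ℤ) rfl).injective hg)]
  by_cases h₁ : n = 1
  · subst h₁
    exact (one_iff.1 k₁).unique (one_iff.1 k₂)
  · rw [eq_zero_of_ne h' hι' h₀ h₁ e₁, eq_zero_of_ne h' hι' h₀ h₁ e₂]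

lemma add (h : IsHeart ι) (h' : IsHeart ι') {A B : H} {n : ℤ}
    {e₁ e₂ : ShiftedHom (ι.obj A) (ι.obj B) n}
    {e₁' e₂' : ShiftedHom (ι'.obj A) (ι'.obj B) n} (k₁ : GradedRel ι ι' e₁ e₁')
    (k₂ : GradedRel ι ι' e₂ e₂') : GradedRel ι ι' (e₁ + e₂) (e₁' + e₂') := by
  by_cases h₀ : n = 0
  · subst h₀
    obtain ⟨f, rfl, rfl⟩ := zero_iff.1 k₁
    obtain ⟨g, rfl, rfl⟩ := zero_iff.1 k₂
    exact zero_iff.2 ⟨f + g, by simp [ShiftedHom.mk₀], by simp [ShiftedHom.mk₀]⟩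
  by_cases h₁ : n = 1
  · subst h₁
    exact one_iff.2 ((one_iff.1 k₁).add h h' (one_iff.1 k₂))
  · exact of_ne h₀ h₁ _ _

lemma zero (h : IsHeart ι) (h' : IsHeart ι') (A B : H) (n : ℤ) :
    GradedRel ι ι' (0 : ShiftedHom (ι.obj A) (ι.obj B) n) 0 := by
  by_cases h₀ : n = 0
  · subst h₀
    exact zero_iff.2 ⟨0, by simp [ShiftedHom.mk₀], by simp [ShiftedHom.mk₀]⟩
  by_cases h₁ : n = 1
  · subst h₁
    obtain ⟨e, he⟩ := SameExt.exists_right (ι' := ι') h h'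
      (0 : ι.obj A ⟶ (ι.obj B)⟦(1 : ℤ)⟧)
    have := he.comp_left h h' (0 : A ⟶ A)
    simp only [Functor.map_zero, zero_comp] at this
    exact one_iff.2 this
  · exact of_ne h₀ h₁ _ _

/-- Only the degrees (0,0), (0,1) and (1,0) carry content, and there the claim is functoriality of
`ι`, `ι'` and of extension classes. A product of two classes of degree one lands in degree two. -/
lemma comp (h : IsHeart ι) (h' : IsHeart ι') (hι : Hereditary ι) (hι' : Hereditary ι') {A B E : H}
    {a b c : ℤ} {e₁ : ShiftedHom (ι.obj A) (ι.obj B) a} {e₂ : ShiftedHom (ι.obj B) (ι.obj E) b}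
    {e₁' : ShiftedHom (ι'.obj A) (ι'.obj B) a} {e₂' : ShiftedHom (ι'.obj B) (ι'.obj E) b}
    (hc : b + a = c) (k₁ : GradedRel ι ι' e₁ e₁') (k₂ : GradedRel ι ι' e₂ e₂') :
    GradedRel ι ι' (e₁.comp e₂ hc) (e₁'.comp e₂' hc) := by
  by_cases ha : a ≠ 0 ∧ a ≠ 1
  · rw [eq_zero_of_ne h hι ha.1 ha.2 e₁, eq_zero_of_ne h' hι' ha.1 ha.2 e₁', ShiftedHom.zero_comp,
      ShiftedHom.zero_comp]
    exact zero h h' _ _ _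
  by_cases hb : b ≠ 0 ∧ b ≠ 1
  · rw [eq_zero_of_ne h hι hb.1 hb.2 e₂, eq_zero_of_ne h' hι' hb.1 hb.2 e₂', ShiftedHom.comp_zero,
      ShiftedHom.comp_zero]
    exact zero h h' _ _ _
  obtain rfl | rfl : a = 0 ∨ a = 1 := by lia
  · obtain ⟨f, rfl, rfl⟩ := zero_iff.1 k₁
    obtain rfl | rfl : b = 0 ∨ b = 1 := by lia
    · obtain rfl : c = 0 := by lia
      obtain ⟨g, rfl, rfl⟩ := zero_iff.1 k₂
      exact zero_iff.2 ⟨f ≫ g, by rw [ShiftedHom.mk₀_comp_mk₀, ι.map_comp], by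
        rw [ShiftedHom.mk₀_comp_mk₀, ι'.map_comp]⟩
    · obtain rfl : c = 1 := by lia
      rw [ShiftedHom.mk₀_comp, ShiftedHom.mk₀_comp, one_iff]
      exact (one_iff.1 k₂).comp_left h h' f
  · obtain rfl | rfl : b = 0 ∨ b = 1 := by lia
    · obtain rfl : c = 1 := by lia
      obtain ⟨g, rfl, rfl⟩ := zero_iff.1 k₂
      rw [ShiftedHom.comp_mk₀, ShiftedHom.comp_mk₀, one_iff]
      exact (one_iff.1 k₁).comp_right h h' g
    · exact of_ne (by lia) (by lia) _ _

end GradedRel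

/-- Triangulated categories generated by the same hereditary heart are equivalent, and the
equivalence preserves the triangles attached to short exact sequences. -/
lemma IsHeart.exists_functor (h : IsHeart ι) (h' : IsHeart ι') (hι : Hereditary ι)
    (hι' : Hereditary ι') (d : Decomposes ι.obj) (d' : Decomposes ι'.obj) :
    ∃ (F : C ⥤ D) (_ : F.CommShift ℤ) (_ : F.Additive), F.IsEquivalence ∧
      ∀ {A B E : H} (f : B ⟶ E) (g : E ⟶ A) (w : f ≫ g = 0),
        (ShortComplex.mk f g w).ShortExact → ∀ e : ι.obj A ⟶ (ι.obj B)⟦(1 : ℤ)⟧,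
        Dist (ι.map f) (ι.map g) e → Common F (ι.map f) (ι.map g) e := by
  obtain ⟨Θ, hΘ⟩ := GradedIso.exists_of_rel (o := ι.obj) (o' := ι'.obj)
    (fun {_ _ _} e e' => GradedRel ι ι' e e')
    (GradedRel.exists_right h h') (fun e' => (GradedRel.exists_right h' h e').imp fun _ k => k.symm)
    (GradedRel.unique h' hι') (fun k₁ k₂ => GradedRel.unique h hι k₁.symm k₂.symm)
    (GradedRel.add h h') (GradedRel.comp h h' hι hι')
  obtain ⟨F, S, hF, u, hF', hu⟩ := d.exists_functor d' Θ
  refine ⟨F, S, hF, hF', fun {A B E} f g w hS e he => ⟨he, ?_⟩⟩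
  -- The degree-zero part of `Θ` says that `u` is a natural isomorphism from `ι ⋙ F` to `ι'`; the
  -- degree-one part then matches the connecting morphisms.
  have nat {X Y : H} (k : X ⟶ Y) : F.map (ι.map k) ≫ (u Y).hom = (u X).hom ≫ ι'.map k := by
    obtain ⟨l, h₁, h₂⟩ := GradedRel.zero_iff.1 (hΘ (ShiftedHom.mk₀ 0 rfl (ι.map k)))
    obtain rfl := ι.map_injective ((ShiftedHom.homEquiv (0 : ℤ) rfl).injective h₁)
    have := hu _ _ _ (ShiftedHom.mk₀ 0 rfl (ι.map k))
    rw [h₂, F.commShiftIso_zero, Functor.CommShift.isoZero_hom_app] at this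
    rw [← cancel_mono ((shiftFunctorZero D ℤ).inv.app _), Category.assoc, Category.assoc]
    have n := (shiftFunctorZero D ℤ).inv.naturality (u Y).hom
    dsimp at n
    simpa [ShiftedHom.mk₀, shiftFunctorZero', ← Functor.map_comp_assoc, n] using this
  obtain ⟨e', he'⟩ := h'.exists_dist f g w hS
  have h₁ : SameExt ι ι' e e' := ⟨E, f, g, w, hS, he, he'⟩
  obtain rfl := h₁.unique (GradedRel.one_iff.1 (hΘ e))
  exact he'.of_iso (u _) (u _) (u _) (nat f) (nat g) (by
    rw [Category.assoc]
    exact hu _ _ _ e)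

end Hearts

/-! ### Exactness -/

section AdditiveClosure

variable {C : Type*} [Category* C] [Preadditive C] [HasZeroObject C] [HasShift C ℤ]
  [∀ n : ℤ, (shiftFunctor C n).Additive] [Pretriangulated C]

lemma additiveClosure_self {P : C → Prop} {X : C} (h : P X) : additiveClosure P X :=
  ⟨1, fun _ => X, fun _ => h, ⟨(biproductUniqueIso (fun _ : Fin 1 => X)).symm⟩⟩

lemma additiveClosure_mono {P Q : C → Prop} (h : ∀ X, P X → Q X) {X : C}
    (hX : additiveClosure P X) : additiveClosure Q X := by
  obtain ⟨n, Y, hY, e⟩ := hX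
  exact ⟨n, Y, fun i => h _ (hY i), e⟩

lemma additiveClosure_of_isZero {P : C → Prop} {X : C} (hX : IsZero X) : additiveClosure P X :=
  ⟨0, Fin.elim0, fun i => i.elim0, ⟨hX.iso ((IsZero.iff_id_eq_zero _).2
    (biproduct.hom_ext _ _ fun i => i.elim0))⟩⟩

lemma isZero_of_additiveClosure {P : C → Prop} (h : ∀ X, ¬ P X) {X : C}
    (hX : additiveClosure P X) : IsZero X := by
  rw [IsZero.iff_id_eq_zero]
  exact hom_eq_zero_of_additiveClosure (fun Y _ hY => (h Y hY).elim) hX hX _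

variable {H : Type*} [Category* H] [Abelian H]

/-- Used to collect the summands of equal degree into a single shifted object of `H`. -/
lemma exists_iso_of_additiveClosure (ι : H ⥤ C) [ι.Additive] {m : ℤ} {X : C}
    (hX : additiveClosure (fun Y => ∃ B : H, Nonempty (Y ≅ (ι.obj B)⟦m⟧)) X) :
    ∃ B : H, Nonempty (X ≅ (ι.obj B)⟦m⟧) := by
  obtain ⟨k, Y, hY, ⟨e⟩⟩ := hX
  choose B hB using hY
  have := Abelian.hasFiniteBiproducts (C := H)
  exact ⟨⨁ B, ⟨e ≪≫ biproduct.mapIso (fun s => (hB s).some) ≪≫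
    ((ι ⋙ shiftFunctor C m).mapBiproduct B).symm⟩⟩

lemma hom_eq_zero_of_shift {X Y : C} {m n k : ℤ} (hk : m + k = n)
    (h : ∀ f : X ⟶ Y⟦k⟧, f = 0) (φ : X⟦m⟧ ⟶ Y⟦n⟧) : φ = 0 := by
  have := h ((shiftShiftNeg X m).inv ≫ φ⟦-m⟧' ≫
    (shiftFunctorAdd' C n (-m) k (by lia)).inv.app Y)
  rw [Preadditive.IsIso.comp_left_eq_zero, Preadditive.IsIso.comp_right_eq_zero] at this
  exact (shiftFunctor C (-m)).map_injective (this.trans (Functor.map_zero _ _ _).symm)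

lemma IsHeart.hom_eq_zero {ι : H ⥤ C} [ι.Full] [ι.Faithful] [ι.Additive] (h : IsHeart ι) {A B : H}
    {m n : ℤ} (hn : n < m) (φ : (ι.obj A)⟦m⟧ ⟶ (ι.obj B)⟦n⟧) : φ = 0 :=
  hom_eq_zero_of_shift (k := n - m) (by lia) (fun f => h.zero_of_neg (by lia) f) φ

lemma Hereditary.hom_eq_zero {ι : H ⥤ C} (h : Hereditary ι) {A B : H} {m n : ℤ} (hn : m + 2 ≤ n)
    (φ : (ι.obj A)⟦m⟧ ⟶ (ι.obj B)⟦n⟧) : φ = 0 :=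
  hom_eq_zero_of_shift (k := n - m) (by lia) (fun f => h _ _ _ (by lia) f) φ

end AdditiveClosure

/-! ### Preservation of triangles, starting from short exact sequences -/

section Exactness

open ZeroObject

variable {H C D : Type*} [Category* H] [Abelian H] [Category* C] [Category* D] [Preadditive C]
  [Preadditive D] [HasZeroObject C] [HasZeroObject D] [HasShift C ℤ] [HasShift D ℤ]
  [∀ n : ℤ, (shiftFunctor C n).Additive] [∀ n : ℤ, (shiftFunctor D n).Additive]
  [Pretriangulated C] [Pretriangulated D] [IsTriangulated C] [IsTriangulated D]
  {ι : H ⥤ C} [ι.Full] [ι.Faithful] [ι.Additive] {F : C ⥤ D} [F.CommShift ℤ] [F.Additive]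
  [F.Full] [F.Faithful]

lemma Common.exists_inv_rot {X Y Z : C} {f : X ⟶ Y} {g : Y ⟶ Z} {h : Z ⟶ X⟦(1 : ℤ)⟧}
    (H : Common F f g h) :
    ∃ h' : Z⟦(-1 : ℤ)⟧ ⟶ X, Common F h' f (g ≫ (shiftNegShift Z (1 : ℤ)).inv) := by
  obtain ⟨h', hh'⟩ : ∃ h' : Z⟦(-1 : ℤ)⟧ ⟶ X,
      h'⟦(1 : ℤ)⟧' = -((shiftNegShift Z (1 : ℤ)).hom ≫ h) := (shiftFunctor C (1 : ℤ)).map_surjective _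
  refine ⟨h', Common.of_rot (H.of_iso (Iso.refl _) (Iso.refl _) (shiftNegShift Z (1 : ℤ))
    (by simp) ?_ ?_)⟩
  · rw [Category.assoc, Iso.inv_hom_id]
    simp
  · simp [hh']

section

variable {A B I K Q E : H} {k : K ⟶ A} {p : A ⟶ I} {j : I ⟶ B} {q : B ⟶ Q}
  {a : A ⟶ E} {b : E ⟶ Q} {φ : E ⟶ B}

/-- If an extension of `Q` by `I = A / K` is the push-out of an extension `E` of `Q` by `A`, then
it is the quotient of `E` by `K`. -/
lemma shortExact_of_pushout (hkp : k ≫ p = 0) (h₁ : (ShortComplex.mk k p hkp).ShortExact)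
    (hjq : j ≫ q = 0) (h₂ : (ShortComplex.mk j q hjq).ShortExact)
    (hab : a ≫ b = 0) (h₃ : (ShortComplex.mk a b hab).ShortExact)
    (hφ₁ : a ≫ φ = p ≫ j) (hφ₂ : φ ≫ q = b) :
    ∃ w : (k ≫ a) ≫ φ = 0, (ShortComplex.mk (k ≫ a) φ w).ShortExact := by
  have hk : Mono k := h₁.mono_f
  have hj : Mono j := h₂.mono_f
  have ha : Mono a := h₃.mono_f
  have hp : Epi p := h₁.epi_g
  have hb : Epi b := h₃.epi_g
  have w : (k ≫ a) ≫ φ = 0 := by rw [Category.assoc, hφ₁, ← Category.assoc, hkp, zero_comp]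
  refine ⟨w, ?_⟩
  have hm : Mono (k ≫ a) := mono_comp _ _
  have he : Epi φ := Preadditive.epi_of_cancel_zero _ (fun {T} u hu => by
    have h₄ : j ≫ u = 0 := by
      rw [← cancel_epi p, ← Category.assoc, ← hφ₁, Category.assoc, hu, comp_zero, comp_zero]
    obtain ⟨v, hv⟩ : ∃ v : Q ⟶ T, q ≫ v = u :=
      ⟨h₂.gIsCokernel.desc (CokernelCofork.ofπ u h₄), h₂.gIsCokernel.fac _ .one⟩
    rw [← hv, ← Category.assoc, hφ₂] at hu
    rw [← hv, (cancel_epi b).1 (hu.trans comp_zero.symm), comp_zero])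
  refine ShortComplex.ShortExact.mk' (ShortComplex.exact_of_f_is_kernel _
    (KernelFork.IsLimit.ofι' _ _ (fun {T} x hx => ?_))) hm he
  dsimp at x hx
  have hxb : x ≫ b = 0 := by rw [← hφ₂, ← Category.assoc, hx, zero_comp]
  have hy : h₃.fIsKernel.lift (KernelFork.ofι x hxb) ≫ a = x := h₃.fIsKernel.fac _ .zero
  have hyp : h₃.fIsKernel.lift (KernelFork.ofι x hxb) ≫ p = 0 := by
    rw [← cancel_mono j, Category.assoc, ← hφ₁, ← Category.assoc, hy, hx, zero_comp]
  have hz : h₁.fIsKernel.lift (KernelFork.ofι _ hyp) ≫ k = _ := h₁.fIsKernel.fac _ .zero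
  refine ⟨h₁.fIsKernel.lift (KernelFork.ofι _ hyp), ?_⟩
  dsimp
  rw [← Category.assoc, hz]
  exact hy

end

section

variable (h : IsHeart ι) (hι : Hereditary ι)
  (hF : ∀ {A B E : H} (f : B ⟶ E) (g : E ⟶ A) (w : f ≫ g = 0),
    (ShortComplex.mk f g w).ShortExact → ∀ e : ι.obj A ⟶ (ι.obj B)⟦(1 : ℤ)⟧,
      Dist (ι.map f) (ι.map g) e → Common F (ι.map f) (ι.map g) e)

include h hι hF

/-- Let `K`, `I`, `Q` be the kernel, image and cokernel of `f`. Heredity allows `f` to be factored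
as a monomorphism `A ⟶ E` with cokernel `Q` followed by an epimorphism `E ⟶ B` with kernel `K`.
Killing first `Q[-1]` and then `K` gives a triangle on `Q[-1] ⊕ K`, `A`, `B` whose second morphism
is `f`; it is determined by two short exact sequences since `Hom(K, Q[-1]) = 0`. -/
lemma good_map {A B : H} (f : A ⟶ B) : Good F (ι.map f) := by
  have h₁ : (ShortComplex.mk (kernel.ι f) (Abelian.factorThruImage f) (by
      rw [← cancel_mono (Abelian.image.ι f)]; simp)).ShortExact := by
    refine ShortComplex.ShortExact.mk' (ShortComplex.exact_of_f_is_kernel _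
      (KernelFork.IsLimit.ofι' _ _ (fun {T} x hx => 
        ⟨kernel.lift f x ?_, kernel.lift_ι _ _ _⟩))) inferInstance inferInstance
    dsimp at x hx
    rw [← Abelian.image.fac f, ← Category.assoc, hx, zero_comp]
  have h₂ : (ShortComplex.mk (Abelian.image.ι f) (cokernel.π f) (by
      simp)).ShortExact :=
    ShortComplex.ShortExact.mk' (ShortComplex.exact_of_f_is_kernel _
      (kernelIsKernel (cokernel.π f))) inferInstance inferInstance
  obtain ⟨d, hd⟩ := h.exists_dist _ _ _ h₁
  obtain ⟨e, he⟩ := h.exists_dist _ _ _ h₂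
  -- The obstruction to lifting the class `e` of `B` from `I[1]` to `A[1]` is the product of `e`
  -- with `d`, up to sign; it has degree two.
  obtain ⟨l, hl⟩ := hd.shift_one.lift₃ e (by
    have := hι _ _ 2 le_rfl ((e ≫ (-d⟦(1 : ℤ)⟧')) ≫
      (shiftFunctorAdd' C (1 : ℤ) 1 2 rfl).inv.app _)
    rwa [Preadditive.IsIso.comp_right_eq_zero] at this)
  obtain ⟨E, a, b, w, h₃, hl'⟩ := h.exists_shortExact l
  obtain ⟨φ, hφ₁, hφ₂⟩ := hl'.exists_hom₂ he (ι.map (Abelian.factorThruImage f)) (𝟙 _) (by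
    rw [Category.id_comp, hl])
  obtain ⟨ψ, rfl⟩ := ι.map_surjective φ
  rw [← ι.map_comp, ← ι.map_comp] at hφ₁
  rw [Category.comp_id, ← ι.map_comp] at hφ₂
  replace hφ₁ := ι.map_injective hφ₁
  replace hφ₂ := ι.map_injective hφ₂
  obtain ⟨w', h₄⟩ := shortExact_of_pushout _ h₁ _ h₂ _ h₃ hφ₁ hφ₂.symm
  obtain ⟨x, hx⟩ := h.exists_dist _ _ _ h₄
  obtain ⟨c, hc⟩ := (hF _ _ _ h₃ _ hl').exists_inv_rot
  have s := Splitting.biprod ((ι.obj (cokernel f))⟦(-1 : ℤ)⟧) (ι.obj (kernel f))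
  obtain ⟨γ, hγ, -⟩ := Common.of_source_splitting s
    (fun φ => h.zero_of_neg (by lia) φ)
    (f := s.fst ≫ c + s.snd ≫ ι.map (kernel.ι f)) (α := ι.map a) (by simpa using hc)
    (p := ι.map ψ) (r := x) (by
      have := hF _ _ _ h₄ _ hx
      rw [ι.map_comp] at this
      simpa using this)
  rw [← ι.map_comp, hφ₁, Abelian.image.fac] at hγ
  exact hγ.rot.good

/-- Only the summands of `Y` in degrees 0 and 1 matter, say `B` and `E[1]`; on the others `f` is
zero. The component in `E[1]` is an extension class, whose fibre is the middle term `P`, and on `P`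
the remaining component is a morphism `P ⟶ B` of `H`. -/
lemma good_of_obj (d : Decomposes ι.obj) {A : H} {Y : C} (f : ι.obj A ⟶ Y) : Good F f := by
  obtain ⟨Y₁, Y', hY₁, hY', ⟨e⟩⟩ := exists_biprod_of_additiveClosure
    (fun Y => ∃ B : H, Nonempty (Y ≅ (ι.obj B)⟦(1 : ℤ)⟧)) (d Y)
  obtain ⟨Y₀, R, hY₀, hR, ⟨e'⟩⟩ := exists_biprod_of_additiveClosure
    (fun Y => ∃ B : H, Nonempty (Y ≅ (ι.obj B)⟦(0 : ℤ)⟧)) hY'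
  obtain ⟨E, ⟨i₁⟩⟩ := exists_iso_of_additiveClosure ι (additiveClosure_mono (fun _ h => h.2) hY₁)
  obtain ⟨B, ⟨i₀'⟩⟩ := exists_iso_of_additiveClosure ι (additiveClosure_mono (fun _ h => h.2) hY₀)
  let i₀ : Y₀ ≅ ι.obj B := i₀' ≪≫ (shiftFunctorZero C ℤ).app _
  have hR' (g : ι.obj A ⟶ R) : g = 0 := by
    refine hom_eq_zero_of_additiveClosure ?_ (additiveClosure_self (P := fun Z => Z = ι.obj A) rfl)
      hR g
    rintro _ Z rfl ⟨⟨⟨B, m, ⟨i⟩⟩, h₁⟩, h₀⟩ φ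
    rw [← cancel_mono i.hom, zero_comp]
    obtain hm | hm | hm | hm : m < 0 ∨ m = 0 ∨ m = 1 ∨ 2 ≤ m := by lia
    · exact h.zero_of_neg hm _
    · subst hm
      exact (h₀ ⟨_, ⟨i⟩⟩).elim
    · subst hm
      exact (h₁ ⟨_, ⟨i⟩⟩).elim
    · exact hι _ _ _ hm _
  have t : Splitting ((ι.obj E)⟦(1 : ℤ)⟧ ⊞ ι.obj B) R Y :=
    (Splitting.biprod _ _).ofIso ((biprod.mapIso (biprod.mapIso i₁.symm i₀.symm) (Iso.refl R)) ≪≫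
      biprod.associator _ _ _ ≪≫ biprod.mapIso (Iso.refl _) e' ≪≫ e)
  have hf : f = (f ≫ t.fst) ≫ t.inl := by
    have := f ≫= t.total
    rw [Preadditive.comp_add, ← Category.assoc f t.snd, hR' (f ≫ t.snd)] at this
    simpa using this.symm
  rw [hf]
  refine Good.add_target_summand ?_ t
  have s := Splitting.biprod ((ι.obj E)⟦(1 : ℤ)⟧) (ι.obj B)
  obtain ⟨P, a, b, w, hS, hP⟩ := h.exists_shortExact ((f ≫ t.fst) ≫ s.fst)
  refine Good.of_target_splitting s (fun φ => ?_) (f ≫ t.fst) (hF _ _ _ hS _ hP).rot ?_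
  · rw [← cancel_mono ((shiftFunctorZero C ℤ).inv.app _), zero_comp]
    exact h.hom_eq_zero (by lia) _
  · obtain ⟨g, hg⟩ := ι.map_surjective (ι.map b ≫ (f ≫ t.fst) ≫ s.snd)
    rw [← hg]
    exact good_map h hι hF g

lemma good_of_shift_obj (d : Decomposes ι.obj) {A : H} {m : ℤ} {Y : C} (f : (ι.obj A)⟦m⟧ ⟶ Y) :
    Good F f := by
  refine Good.of_shift (n := -m) ?_
  exact (good_of_obj h hι hF d ((shiftShiftNeg (ι.obj A) m).inv ≫ f⟦-m⟧')).of_iso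
    (shiftShiftNeg (ι.obj A) m) (Iso.refl _) (by
      rw [Iso.hom_inv_id_assoc, Iso.refl_hom, Category.comp_id])

/-- Induction on the number of degrees allowed in `X`. The part with the smallest shift is split off
first, since it receives no non-zero morphism from parts with larger shifts. -/
lemma good_of_bounded (d : Decomposes ι.obj) (k : ℕ) (m₀ : ℤ) {X Y : C} (f : X ⟶ Y)
    (hX : additiveClosure (fun Y => ∃ (A : H) (m : ℤ), m₀ ≤ m ∧ m < m₀ + k ∧
      Nonempty (Y ≅ (ι.obj A)⟦m⟧)) X) : Good F f := by
  induction k generalizing m₀ X Y with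
  | zero =>
    have hX' : IsZero X := isZero_of_additiveClosure (fun Z hZ => by
      obtain ⟨A, m, h₁, h₂, -⟩ := hZ
      lia) hX
    have h₀ : IsZero (ι.obj 0) := ι.map_isZero (isZero_zero H)
    exact (good_of_obj h hι hF d (0 : ι.obj 0 ⟶ Y)).of_iso (hX'.iso h₀) (Iso.refl _)
      (hX'.eq_of_src _ _)
  | succ k ih =>
    obtain ⟨X₁, X₂, h₁, h₂, ⟨e⟩⟩ := exists_biprod_of_additiveClosure
      (fun Y => ∃ B : H, Nonempty (Y ≅ (ι.obj B)⟦m₀⟧)) hX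
    obtain ⟨E, ⟨i₁⟩⟩ := exists_iso_of_additiveClosure ι (additiveClosure_mono (fun _ h => h.2) h₁)
    have h₂' : additiveClosure (fun Y => ∃ (A : H) (m : ℤ), m₀ + 1 ≤ m ∧ m < m₀ + 1 + k ∧
        Nonempty (Y ≅ (ι.obj A)⟦m⟧)) X₂ := by
      refine additiveClosure_mono ?_ h₂
      rintro Z ⟨⟨A, m, hm, hm', ⟨i⟩⟩, hZ⟩
      have : m ≠ m₀ := by
        rintro rfl
        exact hZ ⟨_, ⟨i⟩⟩
      exact ⟨A, m, by lia, by lia, ⟨i⟩⟩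
    refine Good.of_source_splitting
      ((Splitting.biprod _ _).ofIso (biprod.mapIso i₁.symm (Iso.refl X₂) ≪≫ e))
      (fun φ => ?_) f (good_of_shift_obj h hι hF d _) (fun g => ih (m₀ + 1) g h₂')
    refine hom_eq_zero_of_additiveClosure ?_ h₂'
      (additiveClosure_self (P := fun Z => Z = (ι.obj E)⟦m₀⟧) rfl) φ
    rintro Z _ ⟨A, m, hm, -, ⟨i⟩⟩ rfl ψ
    rw [← cancel_epi i.inv, comp_zero]
    exact h.hom_eq_zero (by lia) _

lemma good_of_decomposes (d : Decomposes ι.obj) {X Y : C} (f : X ⟶ Y) : Good F f := by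
  obtain ⟨n, Z, hZ, ⟨e⟩⟩ := d X
  choose i m hm using hZ
  -- With `N` the sum of the absolute values, all shifts lie in the window from `-N` to `N`, of
  -- length `2N + 1`.
  refine good_of_bounded h hι hF d (2 * ∑ s, (m s).natAbs + 1) (-(∑ s, (m s).natAbs : ℕ)) f
    ⟨n, Z, fun s => ⟨i s, m s, ?_, ?_, hm s⟩, ⟨e⟩⟩
  all_goals
    have : (m s).natAbs ≤ ∑ s, (m s).natAbs := Finset.single_le_sum (f := fun s => (m s).natAbs) (fun _ _ => Nat.zero_le _)
      (Finset.mem_univ s)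
    lia

/-- One triangle with distinguished image on each morphism suffices, because any other triangle on
it is isomorphic to that one. -/
lemma isTriangulated_of_decomposes (d : Decomposes ι.obj) : F.IsTriangulated where
  map_distinguished T hT := by
    obtain ⟨Z, g, k, H⟩ := good_of_decomposes h hι hF d T.mor₁
    obtain ⟨e, h₁, h₂⟩ := Dist.exists_iso₃ hT H.1 (Iso.refl _) (Iso.refl _) (by simp)
    exact (H.of_iso (Iso.refl _) (Iso.refl _) e (by simp) h₁ h₂).2

end

/-- Triangulated categories generated by the same hereditary heart are triangle equivalent. -/
theorem IsHeart.triangleEquivalent {H C D : Type*} [Category* H] [Abelian H] [Category* C]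
    [Category* D] [Preadditive C]
    [Preadditive D] [HasZeroObject C] [HasZeroObject D] [HasShift C ℤ] [HasShift D ℤ]
    [∀ n : ℤ, (shiftFunctor C n).Additive] [∀ n : ℤ, (shiftFunctor D n).Additive]
    [Pretriangulated C] [Pretriangulated D] [IsTriangulated C] [IsTriangulated D]
    {ι : H ⥤ C} [ι.Full] [ι.Faithful] [ι.Additive] {ι' : H ⥤ D} [ι'.Full] [ι'.Faithful]
    [ι'.Additive] (h : IsHeart ι) (h' : IsHeart ι') (hι : Hereditary ι) (hι' : Hereditary ι')
    (d : Decomposes ι.obj) (d' : Decomposes ι'.obj) : TriangleEquivalent C D := by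
  obtain ⟨F, S, hF, hF', hF''⟩ := h.exists_functor h' hι hι' d d'
  exact ⟨F, S, isTriangulated_of_decomposes h hι hF'' d, hF'⟩

end Exactness

/-! ### Criteria for hearts -/

section Criteria

variable {C : Type*} [Category* C] [Preadditive C] [HasZeroObject C] [HasShift C ℤ]
  [∀ n : ℤ, (shiftFunctor C n).Additive] [Pretriangulated C]

/-- A finite direct sum indexed by a disjoint union. -/
noncomputable def biprodBiproductIso {n m : ℕ} (W : Fin n ⊕ Fin m → C) :
    (⨁ fun i => W (.inl i)) ⊞ (⨁ fun j => W (.inr j)) ≅ ⨁ W where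
  hom := biprod.desc (biproduct.desc fun i => biproduct.ι W (.inl i))
    (biproduct.desc fun i => biproduct.ι W (.inr i))
  inv := biproduct.desc (fun j => match j with
    | .inl i => biproduct.ι (fun i => W (.inl i)) i ≫ biprod.inl
    | .inr i => biproduct.ι (fun i => W (.inr i)) i ≫ biprod.inr)
  hom_inv_id := by
    apply biprod.hom_ext'
    · refine biproduct.hom_ext' _ _ (fun j => ?_)
      simp
    · refine biproduct.hom_ext' _ _ (fun j => ?_)
      simp
  inv_hom_id := by
    refine biproduct.hom_ext' _ _ (fun j => ?_)
    rcases j with j | j <;> simp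

lemma additiveClosure_biprod {P : C → Prop} {X Y : C} (hX : additiveClosure P X)
    (hY : additiveClosure P Y) : additiveClosure P (X ⊞ Y) := by
  obtain ⟨n, A, hA, ⟨e⟩⟩ := hX
  obtain ⟨m, B, hB, ⟨e'⟩⟩ := hY
  refine additiveClosure_of_iso ((biprodBiproductIso (Sum.elim A B)).symm ≪≫
    biprod.mapIso e.symm e'.symm) (additiveClosure_biproduct _ ?_)
  rintro (j | j)
  exacts [hA j, hB j]

lemma Dist.exists_splitting {X Y Z : C} {f : X ⟶ Y} {g : Y ⟶ Z} (H : Dist f g 0) :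
    Nonempty (X ⊞ Z ≅ Y) := by
  obtain ⟨l, hl⟩ := H.lift₃ (𝟙 Z) comp_zero
  have := (Splitting.biprod X Z).dist.isIso₂ H (Iso.refl _) (biprod.desc f l) (Iso.refl _)
    (by simp [Splitting.biprod]) (by
      apply biprod.hom_ext' <;> simp [Splitting.biprod, H.comp₁₂, ← hl]) (by simp)
  exact ⟨asIso (biprod.desc f l)⟩

variable {H : Type*} [Category* H] [Abelian H] {ι : H ⥤ C} [ι.Full] [ι.Faithful] [ι.Additive]

/-- Vanishing in negative degrees turns the long exact sequences of the triangle into the universal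
properties of a kernel and of an epimorphism in `H`. -/
lemma shortExact_of_dist
    (h₀ : ∀ {A B : H} {n : ℤ}, n < 0 → ∀ f : ι.obj A ⟶ (ι.obj B)⟦n⟧, f = 0)
    {A B E : H} {f : B ⟶ E} {g : E ⟶ A} {e : ι.obj A ⟶ (ι.obj B)⟦(1 : ℤ)⟧}
    (he : Dist (ι.map f) (ι.map g) e) :
    ∃ w : f ≫ g = 0, (ShortComplex.mk f g w).ShortExact := by
  have h₁ {S T : H} (φ : (ι.obj S)⟦(1 : ℤ)⟧ ⟶ ι.obj T) : φ = 0 := by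
    have := h₀ (by lia) ((shiftShiftNeg (ι.obj S) (1 : ℤ)).inv ≫ φ⟦(-1 : ℤ)⟧')
    rw [Preadditive.IsIso.comp_left_eq_zero] at this
    exact (shiftFunctor C (-1 : ℤ)).map_injective (this.trans (Functor.map_zero _ _ _).symm)
  have w : f ≫ g = 0 := ι.map_injective (by rw [ι.map_comp, he.comp₁₂, ι.map_zero])
  have hf : Mono f := Preadditive.mono_of_cancel_zero _ (fun {T} x hx => by
    obtain ⟨l, hl⟩ := he.lift₁ ((ι.map x)⟦(1 : ℤ)⟧') (by
      rw [← Functor.map_comp, ← Functor.map_comp, hx, Functor.map_zero, Functor.map_zero])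
    rw [h₁ l, zero_comp] at hl
    apply ι.map_injective
    apply (shiftFunctor C (1 : ℤ)).map_injective
    rw [hl, Functor.map_zero, Functor.map_zero])
  have hg : Epi g := Preadditive.epi_of_cancel_zero _ (fun {T} x hx => by
    obtain ⟨l, hl⟩ := he.desc₃ (ι.map x) (by rw [← Functor.map_comp, hx, Functor.map_zero])
    rw [h₁ l, comp_zero] at hl
    exact ι.map_injective (hl.trans (Functor.map_zero _ _ _).symm))
  refine ⟨w, ShortComplex.ShortExact.mk' (ShortComplex.exact_of_f_is_kernel _
    (KernelFork.IsLimit.ofι' _ _ (fun {T} x hx => ?_))) hf hg⟩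
  have : ∃ y : T ⟶ B, y ≫ f = x := by
    have hx' : x ≫ g = 0 := hx
    obtain ⟨l, hl⟩ := he.lift₂ (ι.map x) (by rw [← Functor.map_comp, hx', Functor.map_zero])
    obtain ⟨y, rfl⟩ := ι.map_surjective l
    rw [← ι.map_comp] at hl
    exact ⟨y, (ι.map_injective hl).symm⟩
  exact ⟨this.choose, this.choose_spec⟩

lemma IsHeart.of_middle
    (h₀ : ∀ {A B : H} {n : ℤ}, n < 0 → ∀ f : ι.obj A ⟶ (ι.obj B)⟦n⟧, f = 0)
    (h₁ : ∀ {A B E : H} (f : B ⟶ E) (g : E ⟶ A) (w : f ≫ g = 0),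
      (ShortComplex.mk f g w).ShortExact →
        ∃ e : ι.obj A ⟶ (ι.obj B)⟦(1 : ℤ)⟧, Dist (ι.map f) (ι.map g) e)
    (h₂ : ∀ {A B : H} {X : C} {f : ι.obj B ⟶ X} {g : X ⟶ ι.obj A}
      {e : ι.obj A ⟶ (ι.obj B)⟦(1 : ℤ)⟧}, Dist f g e → ∃ E : H, Nonempty (X ≅ ι.obj E)) :
    IsHeart ι where
  zero_of_neg := h₀
  exists_dist := h₁
  exists_shortExact {A B} e := by
    obtain ⟨X, f, g, hX⟩ := Dist.exists_middle e
    obtain ⟨E, ⟨i⟩⟩ := h₂ hX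
    obtain ⟨f', hf'⟩ := ι.map_surjective (f ≫ i.hom)
    obtain ⟨g', hg'⟩ := ι.map_surjective (i.inv ≫ g)
    have he : Dist (ι.map f') (ι.map g') e :=
      hX.of_iso (Iso.refl _) i.symm (Iso.refl _) (by simp [hf']) (by simp [hg']) (by simp)
    obtain ⟨w, hw⟩ := shortExact_of_dist h₀ he
    exact ⟨E, f', g', w, hw, he⟩

/-- If all products of extensions vanish in one triangulated category with heart `H`, then in a
second one all morphisms of degree at least two vanish, provided that they are effaceable. -/
lemma Hereditary.of_effaceable {D : Type*} [Category* D] [Preadditive D] [HasZeroObject D]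
    [HasShift D ℤ] [∀ n : ℤ, (shiftFunctor D n).Additive] [Pretriangulated D] {κ : H ⥤ D}
    [κ.Full] [κ.Faithful] [κ.Additive] (h : IsHeart ι) (h' : IsHeart κ) (hι : Hereditary ι)
    (heff : ∀ {A B : H} {n : ℤ}, 0 < n → ∀ x : κ.obj A ⟶ (κ.obj B)⟦n⟧,
      ∃ (A' : H) (p : A' ⟶ A), Epi p ∧ κ.map p ≫ x = 0) : Hereditary κ := by
  -- Let `g : E ⟶ R` be the epimorphism of the extension with class `y`. In `C` the corresponding
  -- product vanishes, so the counterpart of `δ` lifts along `g`. This lift is an extension class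
  -- and can be moved back to `D`, where `g` followed by `y` is zero.
  have hprod {A R B : H} (δ : κ.obj A ⟶ (κ.obj R)⟦(1 : ℤ)⟧) (y : κ.obj R ⟶ (κ.obj B)⟦(1 : ℤ)⟧) :
      δ ≫ y⟦(1 : ℤ)⟧' = 0 := by
    obtain ⟨e, he⟩ := SameExt.exists_right h' h δ
    obtain ⟨z, E, f, g, w, hS, hy, hz⟩ := SameExt.exists_right h' h y
    obtain ⟨l, hl⟩ := hz.shift_one.lift₃ e (by
      have := hι _ _ 2 le_rfl ((e ≫ (-z⟦(1 : ℤ)⟧')) ≫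
        (shiftFunctorAdd' C (1 : ℤ) 1 2 rfl).inv.app _)
      rwa [Preadditive.IsIso.comp_right_eq_zero] at this)
    obtain ⟨l', hl'⟩ := SameExt.exists_right h h' l
    have := hl'.comp_right h h' g
    rw [← hl] at this
    rw [he.symm.unique this, Category.assoc, ← Functor.map_comp, hy.comp₂₃, Functor.map_zero,
      comp_zero]
  -- Dimension shifting: an epimorphism effacing `x` writes `x` as its extension class followed by a
  -- morphism of degree one less on the kernel. In degree two this is a product of two classes;
  -- above, induction applies.
  have key (n : ℕ) : ∀ {A B : H} (x : κ.obj A ⟶ (κ.obj B)⟦(n + 2 : ℤ)⟧), x = 0 := by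
    induction n with
    | zero =>
      intro A B x
      obtain ⟨A', p, hp, hx⟩ := heff (by lia) x
      have hS : (ShortComplex.mk (kernel.ι p) p (by simp)).ShortExact :=
        ShortComplex.ShortExact.mk' (ShortComplex.exact_of_f_is_kernel _
          (kernelIsKernel p)) inferInstance hp
      obtain ⟨δ, hδ⟩ := h'.exists_dist _ _ _ hS
      obtain ⟨l, rfl⟩ := hδ.desc₃ x hx
      obtain ⟨y, hy⟩ := (shiftFunctor D (1 : ℤ)).map_surjective
        (l ≫ (shiftFunctorAdd' D (1 : ℤ) 1 _ (by simp)).hom.app _)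
      have := hprod δ y
      rw [hy, ← Category.assoc, Preadditive.IsIso.comp_right_eq_zero] at this
      exact this
    | succ n ih =>
      intro A B x
      obtain ⟨A', p, hp, hx⟩ := heff (by lia) x
      have hS : (ShortComplex.mk (kernel.ι p) p (by simp)).ShortExact :=
        ShortComplex.ShortExact.mk' (ShortComplex.exact_of_f_is_kernel _
          (kernelIsKernel p)) inferInstance hp
      obtain ⟨δ, hδ⟩ := h'.exists_dist _ _ _ hS
      obtain ⟨l, rfl⟩ := hδ.desc₃ x hx
      obtain ⟨y, hy⟩ := (shiftFunctor D (1 : ℤ)).map_surjective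
        (l ≫ (shiftFunctorAdd' D (n + 2 : ℤ) 1 _ (by push_cast; ring)).hom.app _)
      rw [ih y, Functor.map_zero, eq_comm, Preadditive.IsIso.comp_right_eq_zero] at hy
      rw [hy, comp_zero]
  intro A B n hn x
  obtain ⟨k, rfl⟩ : ∃ k : ℕ, n = k + 2 := ⟨(n - 2).toNat, by lia⟩
  exact key k x

end Criteria

/-! ### Hearts inside full triangulated subcategories -/

section Restriction

variable {H C D : Type*} [Category* H] [Abelian H] [Category* C] [Category* D] [Preadditive C]
  [Preadditive D] [HasZeroObject C] [HasZeroObject D] [HasShift C ℤ] [HasShift D ℤ]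
  [∀ n : ℤ, (shiftFunctor C n).Additive] [∀ n : ℤ, (shiftFunctor D n).Additive]
  [Pretriangulated C] [Pretriangulated D] (κ : H ⥤ C) [κ.Full] [κ.Faithful] [κ.Additive]
  (G : C ⥤ D) [G.CommShift ℤ] [G.IsTriangulated] [G.Full] [G.Faithful]

lemma eq_zero_of_comp {A B : H} {n : ℤ}
    (h : ∀ f : (κ ⋙ G).obj A ⟶ ((κ ⋙ G).obj B)⟦n⟧, f = 0) (f : κ.obj A ⟶ (κ.obj B)⟦n⟧) :
    f = 0 := by
  have := h (G.map f ≫ (G.commShiftIso n).hom.app _)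
  rw [Preadditive.IsIso.comp_right_eq_zero] at this
  exact G.map_injective (this.trans (G.map_zero _ _).symm)

variable {κ G}

lemma Hereditary.of_comp (h : Hereditary (κ ⋙ G)) : Hereditary κ :=
  fun A B n hn f => eq_zero_of_comp κ G (h A B n hn) f

lemma dist_of_map {A B E : H} {f : B ⟶ E} {g : E ⟶ A}
    {e : G.obj (κ.obj A) ⟶ (G.obj (κ.obj B))⟦(1 : ℤ)⟧}
    (he : Dist (G.map (κ.map f)) (G.map (κ.map g)) e) :
    ∃ e', Dist (κ.map f) (κ.map g) e' ∧ G.map e' ≫ (G.commShiftIso (1 : ℤ)).hom.app _ = e := by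
  obtain ⟨e', he'⟩ := G.map_surjective (e ≫ (G.commShiftIso (1 : ℤ)).inv.app _)
  have : G.map e' ≫ (G.commShiftIso (1 : ℤ)).hom.app _ = e := by
    rw [he', Category.assoc, Iso.inv_hom_id_app]
    simp
  refine ⟨e', (G.map_distinguished_iff _).1 ?_, this⟩
  have h : Dist (G.map (κ.map f)) (G.map (κ.map g))
      (G.map e' ≫ (G.commShiftIso (1 : ℤ)).hom.app _) := this ▸ he
  exact h

lemma IsHeart.of_comp (h : IsHeart (κ ⋙ G)) : IsHeart κ where
  zero_of_neg hn f := eq_zero_of_comp κ G (h.zero_of_neg hn) f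
  exists_dist f g w hS := by
    obtain ⟨e, he⟩ := h.exists_dist f g w hS
    obtain ⟨e', he', -⟩ := dist_of_map he
    exact ⟨e', he'⟩
  exists_shortExact e := by
    obtain ⟨E, f, g, w, hS, he⟩ := h.exists_shortExact
      (G.map e ≫ (G.commShiftIso (1 : ℤ)).hom.app _)
    obtain ⟨e', he', h'⟩ := dist_of_map he
    rw [cancel_mono] at h'
    obtain rfl := G.map_injective h'
    exact ⟨E, f, g, w, hS, he'⟩

lemma Decomposes.of_comp (h : ∀ X : C, additiveClosure
    (fun Y => ∃ (A : H) (m : ℤ), Nonempty (Y ≅ ((κ ⋙ G).obj A)⟦m⟧)) (G.obj X)) :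
    Decomposes κ.obj := fun X => by
  obtain ⟨n, Y, hY, ⟨e⟩⟩ := h X
  choose A m hA using hY
  refine ⟨n, fun s => (κ.obj (A s))⟦m s⟧, fun s => ⟨A s, m s, ⟨Iso.refl _⟩⟩,
    ⟨G.preimageIso (e ≪≫ biproduct.mapIso (fun s => (hA s).some ≪≫
      ((G.commShiftIso (m s)).app _).symm) ≪≫ (G.mapBiproduct _).symm)⟩⟩

end Restriction

/-! ### The derived category -/

section Derived

open DerivedCategory DerivedCategory.TStructure

variable {H : Type u} [Category.{v} H] [Abelian H] [HasDerivedCategory.{w} H]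

lemma isHeart_singleFunctor : IsHeart (singleFunctor H 0) := by
  refine IsHeart.of_middle (fun {A B n} hn f => ?_)
    (fun f g w hS => ⟨hS.singleδ, hS.singleTriangle_distinguished⟩)
    (fun {A B X f g e} he => ?_)
  · exact (t : TStructure (DerivedCategory H)).zero_of_isLE_of_isGE f 0 (-n) (by lia)
      inferInstance (t.isGE_shift _ 0 n (-n) (by lia))
  · have hX : X.IsGE 0 := t.isGE₂ _ he 0 (inferInstanceAs (((singleFunctor H 0).obj B).IsGE 0))
      (inferInstanceAs (((singleFunctor H 0).obj A).IsGE 0))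
    have hX' : X.IsLE 0 := t.isLE₂ _ he 0 (inferInstanceAs (((singleFunctor H 0).obj B).IsLE 0))
      (inferInstanceAs (((singleFunctor H 0).obj A).IsLE 0))
    exact exists_iso_singleFunctor_obj_of_isGE_of_isLE X 0

/-- Represent `x` by a roof through a complex `K` concentrated in degrees at most 0. Then `K⁰ ⟶ A`
is an epimorphism, as `K` is quasi-isomorphic to `A`, and it effaces `x`, because `B[n]` is zero in
degree 0. -/
lemma exists_epi_singleFunctor_map_comp_eq_zero {A B : H} {n : ℤ} (hn : 0 < n)
    (x : (singleFunctor H 0).obj A ⟶ ((singleFunctor H 0).obj B)⟦n⟧) :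
    ∃ (A' : H) (p : A' ⟶ A), Epi p ∧ (singleFunctor H 0).map p ≫ x = 0 := by
  let S := HomologicalComplex.single H (ComplexShape.up ℤ) 0
  let L : CochainComplex H ℤ := (shiftFunctor (CochainComplex H ℤ) n).obj (S.obj B)
  let i : Q.obj L ≅ ((singleFunctor H 0).obj B)⟦n⟧ := (Q.commShiftIso n).app (S.obj B)
  have hL : CochainComplex.IsStrictlyLE L (-n) :=
    CochainComplex.isStrictlyLE_shift (S.obj B) 0 n (-n) (by lia)
  obtain ⟨K, hK, s, hs, g, hg⟩ := right_fac_of_isStrictlyLE (X := S.obj A) (Y := L) (x ≫ i.inv) 0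
  -- The identity of `K⁰` is a morphism of complexes because `K¹ = 0`.
  let j : S.obj (K.X 0) ⟶ K := HomologicalComplex.mkHomFromSingle (𝟙 _) (fun k hk => by
    obtain rfl : 0 + 1 = k := hk
    exact (K.isZero_of_isStrictlyLE 0 _ (by lia)).eq_of_tgt _ _)
  have hjg : j ≫ g = 0 := by
    refine HomologicalComplex.hom_ext _ _ (fun k => ?_)
    by_cases hk : k = 0
    · subst hk
      exact (L.isZero_of_isStrictlyLE (-n) _ (by lia)).eq_of_tgt _ _
    · exact (HomologicalComplex.isZero_single_obj_X _ _ _ _ hk).eq_of_src _ _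
  obtain ⟨p, hp⟩ := S.map_surjective (j ≫ s)
  refine ⟨K.X 0, p, Preadditive.epi_of_cancel_zero _ (fun {T} c hc => ?_), ?_⟩
  · have h : s ≫ S.map c = 0 := by
      refine HomologicalComplex.hom_ext _ _ (fun k => ?_)
      by_cases hk : k = 0
      · subst hk
        have h₁ : (j ≫ s ≫ S.map c).f 0 = 0 := by
          rw [← Category.assoc, ← hp, ← S.map_comp, hc, S.map_zero]
          rfl
        rw [HomologicalComplex.comp_f, HomologicalComplex.mkHomFromSingle_f, Category.comp_id,
          Preadditive.IsIso.comp_left_eq_zero] at h₁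
        exact h₁
      · exact (HomologicalComplex.isZero_single_obj_X _ _ _ _ hk).eq_of_tgt _ _
    have h' := congrArg Q.map h
    rw [Functor.map_comp, Functor.map_zero, Preadditive.IsIso.comp_left_eq_zero] at h'
    exact (singleFunctor H 0).map_injective
      (h'.trans (Functor.map_zero (singleFunctor H 0) A T).symm)
  · rw [← Preadditive.IsIso.comp_right_eq_zero _ i.inv, Category.assoc]
    have h : Q.map (S.map p) ≫ inv (Q.map s) ≫ Q.map g = 0 := by
      rw [hp, Q.map_comp, Category.assoc, IsIso.hom_inv_id_assoc, ← Q.map_comp, hjg, Q.map_zero]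
    rw [← hg] at h
    exact h

/-- Induction on the amplitude. Truncation splits off the lowest cohomology `A[-a]`; the connecting
morphism goes from summands `B[m]` with `m ≤ -a - 1` to `A[-a + 1]`, so it has degree at least two
and vanishes. The bound on `m` is there for this induction. -/
lemma additiveClosure_single_shift (hH : Hereditary (singleFunctor H 0)) (k : ℕ) (a : ℤ)
    (X : DerivedCategory H) (h₁ : X.IsGE a) (h₂ : X.IsLE (a + k - 1)) :
    additiveClosure (fun Y => ∃ (A : H) (m : ℤ), m ≤ -a ∧
      Nonempty (Y ≅ ((singleFunctor H 0).obj A)⟦m⟧)) X := by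
  induction k generalizing a X with
  | zero => exact additiveClosure_of_isZero (t.isZero X (a + (0 : ℕ) - 1) a (by simp))
  | succ k ih =>
    obtain ⟨X₁, X₃, hX₁, hX₃, f, g, h, hT⟩ := t.exists_triangle X a (a + 1) rfl
    have i₁ : t.IsLE X₁ a := ⟨hX₁⟩
    have i₃ : t.IsGE X₃ (a + 1) := ⟨hX₃⟩
    have i₁' : t.IsGE X₁ a := by
      refine t.isGE₂ _ (inv_rot_of_distTriang _ hT) a ?_ h₁
      have := t.isGE_shift X₃ (a + 1) (-1) (a + 2) (by lia)
      exact t.isGE_of_ge (X₃⟦(-1 : ℤ)⟧) a (a + 2) (by lia)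
    have i₃' : t.IsLE X₃ (a + 1 + k - 1) := by
      refine t.isLE₂ _ (rot_of_distTriang _ hT) _ ?_ ?_
      · exact t.isLE_of_le X (a + (k + 1 : ℕ) - 1) _ (by push_cast; lia)
      · have := t.isLE_shift X₁ a 1 (a - 1) (by lia)
        exact t.isLE_of_le (X₁⟦(1 : ℤ)⟧) (a - 1) _ (by lia)
    have h₃ := ih (a + 1) X₃ i₃ i₃'
    have j₁ := t.isLE_shift X₁ a a 0 (by lia)
    have j₂ := t.isGE_shift X₁ a a 0 (by lia)
    obtain ⟨A, ⟨e⟩⟩ := exists_iso_singleFunctor_obj_of_isGE_of_isLE (X₁⟦a⟧) 0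
    let e' : X₁ ≅ ((singleFunctor H 0).obj A)⟦-a⟧ :=
      (shiftShiftNeg X₁ a).symm ≪≫ (shiftFunctor _ (-a)).mapIso e
    have hz : h = 0 := by
      refine hom_eq_zero_of_additiveClosure ?_ h₃
        (additiveClosure_self (P := fun Z => Z = X₁⟦(1 : ℤ)⟧) rfl) h
      rintro Y _ ⟨B, m, hm, ⟨i⟩⟩ rfl ψ
      have := hH.hom_eq_zero (n := -a + 1) (by lia) (i.inv ≫ ψ ≫ e'.hom⟦(1 : ℤ)⟧' ≫
        (shiftFunctorAdd' _ (-a) 1 _ rfl).inv.app _)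
      rwa [Preadditive.IsIso.comp_left_eq_zero, Preadditive.IsIso.comp_right_eq_zero] at this
    subst hz
    obtain ⟨d⟩ := Dist.exists_splitting hT
    refine additiveClosure_of_iso d (additiveClosure_biprod
      (additiveClosure_self ⟨A, -a, le_rfl, ⟨e'⟩⟩) (additiveClosure_mono ?_ h₃))
    rintro Z ⟨B, m, hm, i⟩
    exact ⟨B, m, by lia, i⟩

variable (H) in
/-- The embedding of an abelian category in its bounded derived category. -/
noncomputable def singleBounded : H ⥤ DerivedCategory.Bounded H :=
  (t : TStructure (DerivedCategory H)).bounded.lift (singleFunctor H 0)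
    (fun A => ⟨⟨0, inferInstanceAs (((singleFunctor H 0).obj A).IsGE 0)⟩,
      ⟨0, inferInstanceAs (((singleFunctor H 0).obj A).IsLE 0)⟩⟩)

instance : (singleBounded H).Full :=
  Functor.Full.of_comp_faithful_iso (ObjectProperty.liftCompιIso _ _ _)

instance : (singleBounded H).Faithful :=
  Functor.Faithful.of_comp_iso (ObjectProperty.liftCompιIso _ _ _)

instance : (singleBounded H).Additive where
  map_add := (t : TStructure (DerivedCategory H)).bounded.ι.map_injective
    (singleFunctor H 0).map_add

lemma isHeart_singleBounded : IsHeart (singleBounded H) :=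
  IsHeart.of_comp (G := Bounded.ι) (isHeart_singleFunctor (H := H))

/-- If the bounded derived category can be compared with a hereditary triangulated category, then it
is itself hereditary, and decomposes. -/
lemma hereditary_and_decomposes_singleBounded {C : Type*} [Category* C] [Preadditive C]
    [HasZeroObject C] [HasShift C ℤ] [∀ n : ℤ, (shiftFunctor C n).Additive] [Pretriangulated C]
    {ι : H ⥤ C} [ι.Full] [ι.Faithful] [ι.Additive] (h : IsHeart ι) (hι : Hereditary ι) :
    Hereditary (singleBounded H) ∧ Decomposes (singleBounded H).obj := by
  have hH : Hereditary (singleFunctor H 0) := Hereditary.of_effaceable h isHeart_singleFunctor hι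
    exists_epi_singleFunctor_map_comp_eq_zero
  refine ⟨Hereditary.of_comp (G := Bounded.ι) hH, Decomposes.of_comp (G := Bounded.ι) (fun X => ?_)⟩
  obtain ⟨⟨a, ha⟩, ⟨b, hb⟩⟩ := X.property
  have hb' : X.obj.IsLE (a + (b - a + 1).toNat - 1) := t.isLE_of_le X.obj b _ (by lia)
  refine additiveClosure_mono ?_ (additiveClosure_single_shift hH (b - a + 1).toNat a X.obj ha hb')
  rintro Y ⟨A, m, -, i⟩
  exact ⟨A, m, i⟩

end Derived

/-! ### Orthogonal decompositions -/

section Projection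

variable {C : Type*} [Category* C] [Preadditive C] [HasZeroObject C]
  [HasShift C ℤ] [∀ n : ℤ, (shiftFunctor C n).Additive] [Pretriangulated C]

lemma Splitting.inl_comp_fst {X₁ X₂ X Y₁ Y₂ Y : C} (s : Splitting X₁ X₂ X) (t : Splitting Y₁ Y₂ Y)
    (u : X₁ ⟶ Y₁) (w : X₂ ⟶ Y₂) :
    s.inl ≫ (s.fst ≫ u ≫ t.inl + s.snd ≫ w ≫ t.inr) ≫ t.fst = u := by
  simp

lemma Splitting.inr_comp_snd {X₁ X₂ X Y₁ Y₂ Y : C} (s : Splitting X₁ X₂ X) (t : Splitting Y₁ Y₂ Y)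
    (u : X₁ ⟶ Y₁) (w : X₂ ⟶ Y₂) :
    s.inr ≫ (s.fst ≫ u ≫ t.inl + s.snd ≫ w ≫ t.inr) ≫ t.snd = w := by
  simp

variable {P Q : ObjectProperty C} {a b : C → C} (ha : ∀ X, P (a X)) (hb : ∀ X, Q (b X))
  (s : ∀ X, Splitting (a X) (b X) X) (hPQ : ∀ {X Y : C}, P X → Q Y → ∀ f : X ⟶ Y, f = 0)

include ha hb hPQ

/-- The contribution passing through `b Y` vanishes since it factors through a morphism `a X ⟶ b Y`.
-/
lemma splitting_comp {X Y Z : C} (f : X ⟶ Y) (g : Y ⟶ Z) :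
    (s X).inl ≫ (f ≫ g) ≫ (s Z).fst =
      ((s X).inl ≫ f ≫ (s Y).fst) ≫ (s Y).inl ≫ g ≫ (s Z).fst := by
  have h := (s X).inl ≫= f ≫= (s Y).total =≫ (g ≫ (s Z).fst)
  have h₀ := hPQ (ha X) (hb Y) ((s X).inl ≫ f ≫ (s Y).snd)
  simp only [Preadditive.comp_add, Preadditive.add_comp, Category.assoc] at h
  have h₁ : (s X).inl ≫ f ≫ (s Y).snd ≫ (s Y).inr ≫ g ≫ (s Z).fst = 0 := by
    have := h₀ =≫ ((s Y).inr ≫ g ≫ (s Z).fst)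
    simpa using this
  rw [h₁, add_zero] at h
  simpa using h.symm

/-- The projection to one half of an orthogonal decomposition. -/
def projection : C ⥤ P.FullSubcategory where
  obj X := ⟨a X, ha X⟩
  map {X Y} f := ObjectProperty.homMk ((s X).inl ≫ f ≫ (s Y).fst)
  map_id X := by
    ext
    simp
  map_comp f g := by
    ext
    exact splitting_comp ha hb s hPQ f g

/-- The projection is right adjoint to the inclusion. -/
def projectionAdjunction : P.ι ⊣ projection ha hb s hPQ :=
  Adjunction.mkOfHomEquiv
    { homEquiv X Y :=
        { toFun f := ObjectProperty.homMk (f ≫ (s Y).fst)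
          invFun g := g.hom ≫ (s Y).inl
          left_inv f := by
            change (f ≫ (s Y).fst) ≫ (s Y).inl = f
            apply (s Y).hom_ext'
            · rw [Category.assoc, Category.assoc, (s Y).inl_fst, Category.comp_id]
            · rw [Category.assoc, Category.assoc, (s Y).inl_snd, comp_zero, comp_zero]
              exact (hPQ X.property (hb Y) (f ≫ (s Y).snd)).symm
          right_inv g := by
            ext
            exact (Category.assoc _ _ _).trans
              ((g.hom ≫= (s Y).inl_fst).trans (Category.comp_id _)) }
      homEquiv_naturality_left_symm f g := Category.assoc _ _ _
      homEquiv_naturality_right {X Y Z} f g := by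
        ext
        have h := f ≫= (s Y).total =≫ (g ≫ (s Z).fst)
        have h₁ : f ≫ (s Y).snd ≫ (s Y).inr ≫ g ≫ (s Z).fst = 0 := by
          have := hPQ X.property (hb Y) (f ≫ (s Y).snd) =≫ ((s Y).inr ≫ g ≫ (s Z).fst)
          simpa using this
        simp only [Preadditive.comp_add, Preadditive.add_comp, Category.assoc, Category.id_comp,
          h₁, add_zero] at h
        change (f ≫ g) ≫ (s Z).fst = (f ≫ (s Y).fst) ≫ (s Y).inl ≫ g ≫ (s Z).fst
        simpa using h.symm }

lemma exists_isTriangulated_projection [P.IsTriangulated] :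
    ∃ _ : (projection ha hb s hPQ).CommShift ℤ, (projection ha hb s hPQ).IsTriangulated := by
  let adj := projectionAdjunction ha hb s hPQ
  let S := adj.rightAdjointCommShift ℤ
  have : adj.CommShift ℤ := adj.commShift_of_leftAdjoint ℤ
  exact ⟨S, adj.isTriangulated_rightAdjoint⟩

/-- With orthogonality on both sides, morphisms are diagonal matrices. -/
lemma isEquivalence_projections
    (hQP : ∀ {X Y : C}, Q X → P Y → ∀ f : X ⟶ Y, f = 0) :
    ((projection ha hb s hPQ).prod'
      (projection hb ha (fun X => (s X).symm) hQP)).IsEquivalence := by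
  have hf : ((projection ha hb s hPQ).prod'
      (projection hb ha (fun X => (s X).symm) hQP)).Faithful := ⟨fun {X Y f g} h => by
    have h₁ : (s X).inl ≫ f ≫ (s Y).fst = (s X).inl ≫ g ≫ (s Y).fst :=
      congrArg (fun k => k.1.hom) h
    have h₂ : (s X).inr ≫ f ≫ (s Y).snd = (s X).inr ≫ g ≫ (s Y).snd :=
      congrArg (fun k => k.2.hom) h
    apply (s X).hom_ext <;> apply (s Y).hom_ext'
    · simpa using h₁
    · exact (hPQ (ha X) (hb Y) _).trans (hPQ (ha X) (hb Y) _).symm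
    · exact (hQP (hb X) (ha Y) _).trans (hQP (hb X) (ha Y) _).symm
    · simpa using h₂⟩
  have hf' : ((projection ha hb s hPQ).prod'
      (projection hb ha (fun X => (s X).symm) hQP)).Full := ⟨fun {X Y} k => by
    refine ⟨(s X).fst ≫ k.1.hom ≫ (s Y).inl + (s X).snd ≫ k.2.hom ≫ (s Y).inr, ?_⟩
    refine Prod.ext ?_ ?_
    · ext
      exact Splitting.inl_comp_fst (s X) (s Y) k.1.hom k.2.hom
    · ext
      exact Splitting.inr_comp_snd (s X) (s Y) k.1.hom k.2.hom⟩
  have he : ((projection ha hb s hPQ).prod'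
      (projection hb ha (fun X => (s X).symm) hQP)).EssSurj := ⟨fun ⟨A, B⟩ => by
    have key {P Q : ObjectProperty C} {a b : C → C} (ha : ∀ X, P (a X)) (hb : ∀ X, Q (b X))
        (s : ∀ X, Splitting (a X) (b X) X) (hPQ : ∀ {X Y : C}, P X → Q Y → ∀ f : X ⟶ Y, f = 0)
        (A : P.FullSubcategory) (B : Q.FullSubcategory) {X : C} (t : Splitting A.obj B.obj X) :
        Nonempty ((projection ha hb s hPQ).obj X ≅ A) := by
      refine ⟨⟨ObjectProperty.homMk ((s X).inl ≫ t.fst), ObjectProperty.homMk (t.inl ≫ (s X).fst),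
        ?_, ?_⟩⟩
      · ext
        change ((s X).inl ≫ t.fst) ≫ t.inl ≫ (s X).fst = 𝟙 (a X)
        have h := (s X).inl ≫= t.total =≫ (s X).fst
        have h₁ : (s X).inl ≫ t.snd ≫ t.inr ≫ (s X).fst = 0 := by
          have := hPQ (ha X) B.property ((s X).inl ≫ t.snd) =≫ (t.inr ≫ (s X).fst)
          simpa using this
        simpa [Preadditive.comp_add, Preadditive.add_comp, h₁] using h
      · ext
        change (t.inl ≫ (s X).fst) ≫ (s X).inl ≫ t.fst = 𝟙 A.obj
        have h := t.inl ≫= (s X).total =≫ t.fst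
        have h₁ : t.inl ≫ (s X).snd ≫ (s X).inr ≫ t.fst = 0 := by
          have := hPQ A.property (hb X) (t.inl ≫ (s X).snd) =≫ ((s X).inr ≫ t.fst)
          simpa using this
        simpa [Preadditive.comp_add, Preadditive.add_comp, h₁] using h
    let t := Splitting.biprod A.obj B.obj
    obtain ⟨e₁⟩ := key ha hb s hPQ A B t
    obtain ⟨e₂⟩ := key hb ha (fun X => (s X).symm) hQP B A t.symm
    exact ⟨A.obj ⊞ B.obj, ⟨Iso.prod e₁ e₂⟩⟩⟩
  exact { }

end Projection

/-! ### Orthogonal classes of indecomposables in a block -/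

section Block

variable {C : Type u} [Category.{v} C] [Preadditive C] [HasZeroObject C]
  [HasShift C ℤ] [∀ n : ℤ, (shiftFunctor C n).Additive] [Pretriangulated C] [IsTriangulated C]

lemma isStableUnderShift_additiveClosure {R : C → Prop} (h : ∀ (n : ℤ) (X : C), R X → R (X⟦n⟧)) :
    (additiveClosure R).IsStableUnderShift ℤ where
  isStableUnderShiftBy n := ⟨fun _ hX => additiveClosure_shift n (h n) hX⟩

/-- In a block, a class of indecomposable objects which is stable under shifts and orthogonal to its
complement consists of all indecomposable objects as soon as it is non-empty. -/
lemma IsBlock.forall_of_orthogonal (hC : HasIndecomposableDecompositions C) (hblock : IsBlock C)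
    (R : C → Prop) (hR : ∀ (n : ℤ) (X : C), R (X⟦n⟧) ↔ R X)
    (h₁ : ∀ X Y : C, Indecomposable X → Indecomposable Y → R X → ¬ R Y → ∀ f : X ⟶ Y, f = 0)
    (h₂ : ∀ X Y : C, Indecomposable X → Indecomposable Y → R X → ¬ R Y → ∀ f : Y ⟶ X, f = 0)
    {M : C} (hM : Indecomposable M) (hRM : R M) {X : C} (hX : Indecomposable X) : R X := by
  let 𝒜 : ObjectProperty C := additiveClosure fun Y => Indecomposable Y ∧ R Y
  let ℬ : ObjectProperty C := additiveClosure fun Y => Indecomposable Y ∧ ¬ R Y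
  have hA : 𝒜.IsStableUnderShift ℤ := isStableUnderShift_additiveClosure
    (fun n X h => ⟨indecomposable_shift n h.1, (hR n X).2 h.2⟩)
  have hB : ℬ.IsStableUnderShift ℤ := isStableUnderShift_additiveClosure
    (fun n X h => ⟨indecomposable_shift n h.1, fun h' => h.2 ((hR n X).1 h')⟩)
  -- The two halves are introduced as orthogonals, which are triangulated subcategories because `𝒜`
  -- and `ℬ` are stable under shifts; `hPA` and `hQB` show that nothing has been added to `𝒜` and
  -- `ℬ`.
  let P : ObjectProperty C := ℬ.leftOrthogonal
  let Q : ObjectProperty C := 𝒜.leftOrthogonal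
  have hAP {X : C} (hX : 𝒜 X) : P X := fun Y f hY =>
    hom_eq_zero_of_additiveClosure (fun S T hS hT f => h₁ S T hS.1 hT.1 hS.2 hT.2 f) hX hY f
  have hBQ {X : C} (hX : ℬ X) : Q X := fun Y f hY =>
    hom_eq_zero_of_additiveClosure (fun S T hS hT f => h₂ T S hT.1 hS.1 hT.2 hS.2 f) hX hY f
  have dec (X : C) : ∃ A B : C, 𝒜 A ∧ ℬ B ∧ Nonempty (Splitting A B X) := by
    obtain ⟨A, B, hA, hB, ⟨e⟩⟩ := exists_biprod_of_additiveClosure R (hC X)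
    exact ⟨A, B, hA, hB, ⟨(Splitting.biprod A B).ofIso e⟩⟩
  have hPA {X : C} (hX : P X) : 𝒜 X := by
    obtain ⟨A, B, hA, hB, ⟨s⟩⟩ := dec X
    refine additiveClosure_of_iso ⟨s.inl, s.fst, s.inl_fst, ?_⟩ hA
    simpa [hX s.snd hB] using s.total
  have hQB {X : C} (hX : Q X) : ℬ X := by
    obtain ⟨A, B, hA, hB, ⟨s⟩⟩ := dec X
    refine additiveClosure_of_iso ⟨s.inr, s.snd, s.inr_snd, ?_⟩ hB
    simpa [hX s.fst hA] using s.total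
  choose a b ha hb s using dec
  obtain ⟨S₁, hS₁⟩ := exists_isTriangulated_projection (P := P) (Q := Q) (fun X => hAP (ha X))
    (fun X => hBQ (hb X)) (fun X => (s X).some) (fun hX hY f => hX f (hQB hY))
  obtain ⟨S₂, hS₂⟩ := exists_isTriangulated_projection (P := Q) (Q := P) (fun X => hBQ (hb X))
    (fun X => hAP (ha X)) (fun X => (s X).some.symm) (fun hX hY f => hX f (hPA hY))
  by_contra hRX
  obtain h | h := hblock P.FullSubcategory Q.FullSubcategory _ _ hS₁ hS₂
    (isEquivalence_projections _ _ _ _ _)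
  · have hM' : P M := hAP (additiveClosure_self ⟨hM, hRM⟩)
    exact hM.1 (P.ι.map_isZero (h ⟨M, hM'⟩))
  · have hX' : Q X := hBQ (additiveClosure_self ⟨hX, hRX⟩)
    exact hX.1 (Q.ι.map_isZero (h ⟨X, hX'⟩))

end Block

/-! ### Paths -/

section Paths

variable {C : Type u} [Category.{v} C] [Preadditive C] [HasZeroObject C]
  [HasShift C ℤ] [∀ n : ℤ, (shiftFunctor C n).Additive] [Pretriangulated C]

/-- A retract of an indecomposable object is trivial. -/
lemma isZero_or_of_retract {A Y : C} (hY : Indecomposable Y) (l : A ⟶ Y) (r : Y ⟶ A)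
    (h : l ≫ r = 𝟙 A) : IsZero A ∨ r ≫ l = 𝟙 Y := by
  obtain ⟨W, p, k, H⟩ := Dist.exists_cone l
  -- A split monomorphism has a zero connecting morphism, so `Y` is the sum of `A` and the cone `W`.
  have hk : k = 0 := by
    have := H.comp₃₁ =≫ r⟦(1 : ℤ)⟧'
    rwa [Category.assoc, ← Functor.map_comp, h, CategoryTheory.Functor.map_id, Category.comp_id,
      zero_comp] at this
  subst hk
  obtain ⟨e⟩ := H.exists_splitting
  refine (hY.2 _ _ e.symm).imp_right (fun hW => ?_)
  obtain ⟨m, hm⟩ := H.lift₂ (𝟙 Y) (hW.eq_of_tgt _ _)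
  rw [← Category.id_comp (r ≫ l), hm, Category.assoc, reassoc_of% h]

lemma HasPath.refl {X : C} (h : Indecomposable X) : HasPath X X := ⟨h, h, .refl⟩

lemma HasPath.trans {X Y Z : C} (h : HasPath X Y) (h' : HasPath Y Z) : HasPath X Z :=
  ⟨h.1, h'.2.1, h.2.2.trans h'.2.2⟩

lemma HasPath.hom {X Y : C} (hX : Indecomposable X) (hY : Indecomposable Y) (f : X ⟶ Y)
    (hf : f ≠ 0) : HasPath X Y :=
  (HasPath.refl hX).of_hom hY f hf

/-- A non-zero morphism `X ⟶ Y` between indecomposable objects yields a path from `Y` to `X[1]`. -/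
lemma HasPath.of_hom_shift (hC : HasIndecomposableDecompositions C) {X Y : C}
    (hX : Indecomposable X) (hY : Indecomposable Y) (f : X ⟶ Y) (hf : f ≠ 0) :
    HasPath Y (X⟦(1 : ℤ)⟧) := by
  by_contra hpath
  obtain ⟨Z, g, h, H⟩ := Dist.exists_cone f
  -- Split the cone into the part `A` reachable from `Y` and the rest. The morphism `g` lands in
  -- `A`, and `h` vanishes on `A`, since otherwise `X[1]` would be reachable. Hence `A` is a retract
  -- of the indecomposable `Y`.
  obtain ⟨A, B, hA, hB, ⟨e⟩⟩ := exists_biprod_of_additiveClosure (HasPath Y) (hC Z)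
  let s := (Splitting.biprod A B).ofIso e
  have hgB : g ≫ s.snd = 0 := hom_eq_zero_of_additiveClosure (P := fun Z => Z = Y)
    (by
      rintro _ Z rfl hZ φ
      by_contra hφ
      exact hZ.2 (HasPath.hom hY hZ.1 φ hφ)) (additiveClosure_self rfl) hB _
  have hAh : s.inl ≫ h = 0 := hom_eq_zero_of_additiveClosure (Q := fun Z => Z = X⟦(1 : ℤ)⟧)
    (by
      rintro Z _ hZ rfl φ
      by_contra hφ
      exact hpath (hZ.2.of_hom (indecomposable_shift 1 hX) φ hφ)) hA (additiveClosure_self rfl) _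
  obtain ⟨l, hl⟩ := H.lift₃ s.inl hAh
  have hg : (g ≫ s.fst) ≫ s.inl = g := by
    have := g ≫= s.total
    rwa [Preadditive.comp_add, ← Category.assoc g s.snd, hgB, zero_comp, add_zero,
      Category.comp_id, ← Category.assoc] at this
  obtain hA₀ | hl' := isZero_or_of_retract hY l (g ≫ s.fst) (by
    rw [← Category.assoc, ← hl, s.inl_fst])
  -- If `A = 0`, then `g = 0` and `f` is a split epimorphism, hence an isomorphism, so that `X[1] ≅
  -- Y[1]` is reachable after all. In the other case `g` is a split monomorphism, and `f ≫ g = 0`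
  -- gives `f = 0`.
  · obtain ⟨m, hm⟩ := H.lift₂ (𝟙 Y) (by
      rw [← hg, hA₀.eq_of_tgt (g ≫ s.fst) 0, zero_comp, comp_zero])
    obtain hY₀ | hfm := isZero_or_of_retract hX m f hm.symm
    · exact hY.1 hY₀
    · let i : Y ≅ X := ⟨m, f, hm.symm, hfm⟩
      exact hpath ((HasPath.refl hY).shift.of_iso ((shiftFunctor C (1 : ℤ)).mapIso i))
  · apply hf
    rw [← Category.comp_id f, ← hl', ← Category.assoc, ← Category.assoc, H.comp₁₂, zero_comp,
      zero_comp]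

lemma PathStep.shift_int {X Y : C} (n : ℤ) (h : PathStep X Y) : PathStep (X⟦n⟧) (Y⟦n⟧) := by
  refine ⟨indecomposable_shift n h.1, indecomposable_shift n h.2.1, h.2.2.imp ?_ ?_⟩
  · rintro ⟨f, hf⟩
    exact ⟨f⟦n⟧', fun h => hf ((shiftFunctor C n).map_injective
      (h.trans (Functor.map_zero _ _ _).symm))⟩
  · rintro ⟨e⟩
    exact ⟨(shiftFunctor C n).mapIso e ≪≫ shiftComm X 1 n⟩

lemma HasPath.shift_int {X Y : C} (n : ℤ) (h : HasPath X Y) : HasPath (X⟦n⟧) (Y⟦n⟧) :=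
  ⟨indecomposable_shift n h.1, indecomposable_shift n h.2.1,
    h.2.2.lift (fun Z => Z⟦n⟧) fun _ _ h => h.shift_int n⟩

lemma HasPath.shift_add {X Y : C} {a b c : ℤ} (h : HasPath X (Y⟦a⟧)) (hc : a + b = c) :
    HasPath (X⟦b⟧) (Y⟦c⟧) :=
  (h.shift_int b).of_iso ((shiftFunctorAdd' C a b c hc).symm.app Y)

lemma HasPath.of_iso_left {X X' Y : C} (h : HasPath X Y) (e : X ≅ X') : HasPath X' Y :=
  ((HasPath.refl (indecomposable_of_iso e h.1)).of_iso e.symm).trans h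

lemma HasPath.of_le {X Y : C} {a b : ℤ} (h : HasPath X (Y⟦a⟧)) (hab : a ≤ b) :
    HasPath X (Y⟦b⟧) := by
  obtain ⟨k, rfl⟩ : ∃ k : ℕ, b = a + k := ⟨(b - a).toNat, by lia⟩
  clear hab
  induction k with
  | zero => simpa using h
  | succ k ih =>
    exact ih.shift.of_iso ((shiftFunctorAdd' C (a + k) 1 _ (by push_cast; ring)).symm.app Y)

variable [IsTriangulated C]

/-- The class of such `X` is orthogonal to its complement: non-zero morphisms out of the class
prolong paths directly, and those into it do so, after a shift, by `HasPath.of_hom_shift`. -/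
lemma HasPath.exists_shift (hC : HasIndecomposableDecompositions C) (hblock : IsBlock C) {M X : C}
    (hM : Indecomposable M) (hX : Indecomposable X) : ∃ n : ℤ, HasPath M (X⟦n⟧) := by
  refine hblock.forall_of_orthogonal hC (fun X => ∃ n : ℤ, HasPath M (X⟦n⟧)) (fun n X => ?_)
    (fun X Y hX hY h h' f => ?_) (fun X Y hX hY h h' f => ?_) hM
    ⟨0, (HasPath.refl hM).of_iso ((shiftFunctorZero C ℤ).symm.app M)⟩ hX
  · constructor
    · rintro ⟨m, h⟩
      exact ⟨n + m, h.of_iso ((shiftFunctorAdd C n m).symm.app X)⟩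
    · rintro ⟨m, h⟩
      exact ⟨m - n, h.of_iso ((shiftFunctorAdd' C n (m - n) m (by lia)).app X)⟩
  · by_contra hf
    obtain ⟨n, h⟩ := h
    exact h' ⟨n, h.trans ((HasPath.hom hX hY f hf).shift_int n)⟩
  · by_contra hf
    obtain ⟨n, h⟩ := h
    exact h' ⟨1 + n, h.trans ((HasPath.of_hom_shift hC hY hX f hf).shift_add rfl)⟩

lemma HasPath.exists_to_shift (hC : HasIndecomposableDecompositions C) (hblock : IsBlock C)
    {M X : C} (hM : Indecomposable M) (hX : Indecomposable X) : ∃ n : ℤ, HasPath X (M⟦n⟧) := by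
  refine hblock.forall_of_orthogonal hC (fun X => ∃ n : ℤ, HasPath X (M⟦n⟧)) (fun n X => ?_)
    (fun X Y hX hY h h' f => ?_) (fun X Y hX hY h h' f => ?_) hM
    ⟨0, (HasPath.refl hM).of_iso ((shiftFunctorZero C ℤ).symm.app M)⟩ hX
  · constructor
    · rintro ⟨m, h⟩
      exact ⟨m - n, (h.shift_add (b := -n) (by lia)).of_iso_left (shiftShiftNeg X n)⟩
    · rintro ⟨m, h⟩
      exact ⟨m + n, h.shift_add rfl⟩
  · by_contra hf
    obtain ⟨n, h⟩ := h
    exact h' ⟨n + 1, (HasPath.of_hom_shift hC hX hY f hf).trans (h.shift_add rfl)⟩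
  · by_contra hf
    obtain ⟨n, h⟩ := h
    exact h' ⟨n, (HasPath.hom hY hX f hf).trans h⟩

/-- Every indecomposable object has a shift which lies in the heart. -/
lemma exists_shift_mem_heart (hC : HasIndecomposableDecompositions C) (hblock : IsBlock C) {M X : C}
    (hM : Indecomposable M) (hpath : ¬ HasPath M (M⟦(-1 : ℤ)⟧)) (hX : Indecomposable X) :
    ∃ n : ℤ, aisle M (X⟦n⟧) ∧ coaisle M (X⟦n⟧) := by
  obtain ⟨n₀, h₀⟩ := HasPath.exists_shift hC hblock hM hX
  obtain ⟨k, hk⟩ := HasPath.exists_to_shift hC hblock hM hX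
  -- For `n < -k` the paths from `M` to `X[n]` and from `X[n]` to `M[k + n]` would compose to one
  -- from `M` to a negative shift of `M`, hence to `M[-1]`.
  have hbdd (n : ℤ) (hn : HasPath M (X⟦n⟧)) : -k ≤ n := by
    by_contra hlt
    exact hpath ((hn.trans (hk.shift_add rfl)).of_le (by lia))
  obtain ⟨n, hn, hmin⟩ := Int.exists_least_of_bdd (P := fun n => HasPath M (X⟦n⟧)) ⟨-k, hbdd⟩
    ⟨n₀, h₀⟩
  refine ⟨n, additiveClosure_self hn, additiveClosure_self ⟨indecomposable_shift n hX, fun h => ?_⟩⟩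
  have := hmin (n - 1) (h.of_iso ((shiftFunctorAdd' C n (-1) (n - 1) (by lia)).symm.app X))
  lia

/-- The heart is closed under extensions. A short exact sequence gets its connecting morphism from
the triangle on the epimorphism `g`, whose first vertex is also a kernel of `g`. -/
lemma isHeart_heart (t : TStructure C) : IsHeart t.heart.ι := by
  have h₀ {A B : t.heart.FullSubcategory} {n : ℤ} (hn : n < 0)
    (f : t.heart.ι.obj A ⟶ (t.heart.ι.obj B)⟦n⟧) : f = 0 := heart_hom_eq_zero t f hn
  refine IsHeart.of_middle h₀ (fun {A B E} f g w hS => ?_) (fun {A B X f g e} he => ?_)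
  · have : Epi g := hS.epi_g
    obtain ⟨K, i, δ, hK⟩ := AbelianSubcategory.exists_distinguished_triangle_of_epi
      (heart_hom_eq_zero t) (heart_admissible t) g
    obtain ⟨w', hS'⟩ := shortExact_of_dist h₀ hK
    let a : B ≅ K := hS.fIsKernel.conePointUniqueUpToIso hS'.fIsKernel
    have ha : a.hom ≫ i = f := hS.fIsKernel.conePointUniqueUpToIso_hom_comp hS'.fIsKernel .zero
    refine ⟨δ ≫ (t.heart.ι.map a.inv)⟦(1 : ℤ)⟧', Dist.of_iso hK (t.heart.ι.mapIso a) (Iso.refl _)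
      (Iso.refl _) ?_ (by simp) ?_⟩
    · rw [Functor.mapIso_hom, ← Functor.map_comp, ha]
      simp
    · rw [Category.assoc, ← Functor.map_comp, Functor.mapIso_hom, ← Functor.map_comp]
      simp
  · have hA := (t.mem_heart_iff _).1 A.property
    have hB := (t.mem_heart_iff _).1 B.property
    exact ⟨⟨X, (t.mem_heart_iff _).2 ⟨t.isLE₂ _ he 0 hB.1 hA.1, t.isGE₂ _ he 0 hB.2 hA.2⟩⟩,
      ⟨Iso.refl _⟩⟩

lemma pathTStructure_heart_iff (hC : HasIndecomposableDecompositions C) (M X : C) :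
    (pathTStructure hC M).heart X ↔ aisle M X ∧ coaisle M X := by
  rw [TStructure.mem_heart_iff, ← pathTStructure_le_zero hC, ← pathTStructure_ge_zero hC]
  exact ⟨fun h => ⟨h.1.le, h.2.ge⟩, fun h => ⟨⟨h.1⟩, ⟨h.2⟩⟩⟩

/-- Let `Y` be a summand of `A` and `Z` a summand of `B[n]`, with `n ≥ 2`; then there is a path from
`M` to `Z[-2]`. A non-zero `Y ⟶ Z` gives a path from `Z` to `Y[1]`, hence from `Z[-2]` to `Y[-1]`,
and so from `M` to `Y[-1]`, contrary to `Y` lying in the coaisle. -/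
lemma hereditary_heart (hC : HasIndecomposableDecompositions C) (M : C) :
    Hereditary (pathTStructure hC M).heart.ι := fun A B n hn f => by
  have hA := ((pathTStructure_heart_iff hC M A.obj).1 A.property).2
  have hB := ((pathTStructure_heart_iff hC M B.obj).1 B.property).1
  refine hom_eq_zero_of_additiveClosure ?_ hA
    (additiveClosure_shift (Q := fun Z => Indecomposable Z ∧ HasPath M (Z⟦(-2 : ℤ)⟧)) n
      (fun Y hY => ⟨indecomposable_shift n hY.2.1, ?_⟩) hB) f
  · intro Y Z hY hZ φ
    by_contra hφ
    exact hY.2 (hZ.2.trans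
      ((HasPath.of_hom_shift hC hY.1 hZ.1 φ hφ).shift_add (b := -2) (by lia)))
  · have h := (hY.of_iso ((shiftFunctorZero C ℤ).symm.app Y)).of_le (b := n - 2) (by lia)
    exact h.of_iso ((shiftFunctorAdd' C n (-2) (n - 2) (by lia)).app Y)

lemma decomposes_heart (hC : HasIndecomposableDecompositions C) (hblock : IsBlock C) {M : C}
    (hM : Indecomposable M) (hpath : ¬ HasPath M (M⟦(-1 : ℤ)⟧)) :
    Decomposes (pathTStructure hC M).heart.ι.obj := fun X => by
  refine additiveClosure_mono (fun Y hY => ?_) (hC X)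
  obtain ⟨n, hn⟩ := exists_shift_mem_heart hC hblock hM hpath hY
  exact ⟨⟨Y⟦n⟧, (pathTStructure_heart_iff hC M _).2 hn⟩, -n, ⟨(shiftShiftNeg Y n).symm⟩⟩

end Paths

end PathTriang

/-! ### Comparison of the block with the bounded derived category of the heart -/

theorem mainTheorem3 {T : Type u} [Category.{v} T] [Preadditive T] [HasZeroObject T]
    [HasShift T ℤ] [∀ n : ℤ, (shiftFunctor T n).Additive] [Pretriangulated T] [IsTriangulated T]
    [EssentiallySmall.{w} T]
    (hT : PathTriang.HasIndecomposableDecompositions T)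
    (hblock : PathTriang.IsBlock T)
    (M : T) (hM : Indecomposable M)
    (hpath : ¬ PathTriang.HasPath M (M⟦(-1 : ℤ)⟧))
    [HasDerivedCategory.{w'} (PathTriang.pathTStructure hT M).heart.FullSubcategory] :
    PathTriang.TriangleEquivalent T
      (DerivedCategory.Bounded (PathTriang.pathTStructure hT M).heart.FullSubcategory) := by
  have h := PathTriang.isHeart_heart (PathTriang.pathTStructure hT M)
  have hι := PathTriang.hereditary_heart hT M
  obtain ⟨hι', d'⟩ := PathTriang.hereditary_and_decomposes_singleBounded h hι
  exact h.triangleEquivalent PathTriang.isHeart_singleBounded hι hι'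
    (PathTriang.decomposes_heart hT hblock hM hpath) d'
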